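/- Let $G$ be a complex semisimple algebraic group with Lie algebra $\mathfrak g$, $\mathfrak h\subset\mathfrak g$ a Cartan subalgebra, $\Delta$ the root system of $(\mathfrak g,\mathfrak h)$, $\Delta_+$ a system of positive roots, $\mathfrak n=\bigoplus_{\alpha\in\Delta_+}\mathfrak g_\alpha$, $\mathfrak b=\mathfrak h\oplus\mathfrak n$ the corresponding Borel subalgebra, and $N\subset G$ the unipotent subgroup corresponding to its nilradical $\mathfrak n$. Choose root vectors $e_\alpha$ ($\alpha\in\Delta$) such that $[e_\alpha,e_{-\alpha}]=h_\alpha$ is the coroot of $\alpha$. For $y=h+\sum_{\gamma\in\Delta}c_\gamma e_\gamma\in\mathfrak g$ with $h\in\mathfrak h$, put $\hat e_\alpha(y)=c_{-\alpha}$ and $\hat h_\alpha(y)=\alpha(h)$. Let $\mathfrak h'=\{h\in\mathfrak h:\alpha(h)\ne0\ \forall\alpha\in\Delta_+\}$ and $\mathfrak b'=\mathfrak h'+\mathfrak n$, and let $\mathbb C[\mathfrak b]'$, $\mathbb C[\mathfrak g]'$ be the algebras obtained from $\mathbb C[\mathfrak b]$, $\mathbb C[\mathfrak g]$ by inverting the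 functions $\hat h_\alpha$, $\alpha\in\Delta_+$ (so elements of $\mathbb C[\mathfrak b]'$ are functions on $\mathfrak b'$). The group $N$ acts on $\mathfrak b$ and $\mathfrak b'$ by the adjoint action, and on functions by $(gf)(y)=f(g^{-1}y)$; $e_\alpha f$ denotes the induced Lie algebra action of $e_\alpha\in\mathfrak n$. 1. The map $N\times\mathfrak h\to\mathfrak b$, $(g,x)\mapsto \mathrm{Ad}(g)x$, is a birational equivalence, and it restricts to a bijection $N\times\mathfrak h'\to\mathfrak b'$. 2. The formula $(Pf)(\mathrm{Ad}(g)x)=f(x)$, $g\in N$, $x\in\mathfrak h'$, defines a linear operator $P$ on $\mathbb C[\mathfrak b]'$, which is a projection onto the subspace $\mathbb C[\mathfrak b]'^N$ of $N$-invariants. 3. For $\alpha\in\Delta_+$ the formula $(P_\alpha f)(y)=f\bigl(\mathrm{Ad}(\exp(\tfrac{c_\alpha}{\alpha(h)}e_\alpha))\,y\bigr)$, $y=h+\sum_{\gamma\in\Delta_+}c_\gamma e_\gamma\in\mathfrak b'$, defines a linear operator $P_\alpha$ on $\mathbb C[\mathfrak b]'$. If $\beta_1,\dots,\beta_m$ is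 a normal ordering of $\Delta_+$ (an enumeration of $\Delta_+$ in which, whenever $\gamma=\alpha+\beta$ with $\alpha,\beta,\gamma\in\Delta_+$, the root $\gamma$ lies between $\alpha$ and $\beta$), then $$P=P_{\beta_m}\cdots P_{\beta_1}.$$ 4. For $\alpha\in\Delta_+$, $f\in\mathbb C[\mathfrak b]'$ and $y\in\mathfrak b'$, $$(P_\alpha f)(y)=\sum_{n=0}^\infty\frac{(-1)^n}{n!}\,\hat h_\alpha(y)^{-n}\,\hat e_{-\alpha}(y)^n\,(e_\alpha^nf)(y),$$ where $e_\alpha^nf=0$ for all large $n$. 5. For a nondegenerate symmetric invariant bilinear form $\kappa$ on $\mathfrak g$, let $\{\cdot,\cdot\}$ be the Kirillov–Kostant Poisson bracket of $\mathfrak g^*$ transported to $\mathfrak g$ by $\kappa$ and extended to $\mathbb C[\mathfrak g]'$. Let $\alpha\in\Delta_+$. Some nonzero multiple $\kappa$ of the Killing form is normalised so that $\{\hat e_\alpha,\hat e_{-\alpha}\}=\hat h_\alpha$ and $\{\hat h_\alpha,\hat e_{\pm\alpha}\}=\pm2\hat e_{\pm\alpha}$. For every $\kappa$ normalised in this way (for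 the given $\alpha$), every $f\in\mathbb C[\mathfrak b]'$, every $\tilde f\in\mathbb C[\mathfrak g]'$ which restricts to $f$ on $\mathfrak b'$, and every $y\in\mathfrak b'$, $$(P_\alpha f)(y)=\sum_{n=0}^\infty\frac{(-1)^n}{n!}\,\hat h_\alpha(y)^{-n}\,\hat e_{-\alpha}(y)^n\,\underbrace{\{\hat e_\alpha,\{\hat e_\alpha,\dots,\{\hat e_\alpha}_{n},\tilde f\}\dots\}\}(y),$$ where the iterated brackets vanish on $\mathfrak b'$ for all large $n$. 6. The kernel of $P$ is the ideal of $\mathbb C[\mathfrak b]'$ generated by the functions $\hat e_{-\alpha}$, $\alpha\in\Delta_+$. -/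

import Mathlib

open LieAlgebra LieAlgebra.IsKilling LieModule Module

noncomputable section

namespace QuasiClassical

/-! ### Polynomial functions, birational maps, localised function algebras -/

/-- The algebra of polynomial (regular) functions on a finite-dimensional complex vector space:
it is generated by the linear functionals. -/
def polyFun (E : Type*) [AddCommGroup E] [Module ℂ E] : Subalgebra ℂ (E → ℂ) :=
  Algebra.adjoin ℂ {f | ∃ l : Dual ℂ E, ∀ v, f v = l v}

/-- `φ` is regular on the principal open subset `q ≠ 0` of the affine variety `X ⊆ E`: each of its
coordinates is there of the form `p / q ^ k` with `p` polynomial. -/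
def IsRegularOnOpen {E F : Type*} [AddCommGroup E] [Module ℂ E] [AddCommGroup F] [Module ℂ F]
    (X : Set E) (q : E → ℂ) (φ : E → F) : Prop :=
  ∀ l : Dual ℂ F, ∃ p ∈ polyFun E, ∃ k : ℕ, ∀ x ∈ X, q x ≠ 0 → l (φ x) = p x / q x ^ k

/-- For irreducible affine varieties `X ⊆ E`, `Y ⊆ F`: the map `φ` is a birational equivalence from
`X` to `Y`, i.e. it restricts to an isomorphism from a nonempty principal open subset of `X` (where
`q ≠ 0`) onto a nonempty principal open subset of `Y` (where `s ≠ 0`), with inverse `ψ`. -/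
def IsBirational {E F : Type*} [AddCommGroup E] [Module ℂ E] [AddCommGroup F] [Module ℂ F]
    (X : Set E) (Y : Set F) (φ : E → F) : Prop :=
  ∃ q ∈ polyFun E, ∃ s ∈ polyFun F, ∃ ψ : F → E,
    (∃ x ∈ X, q x ≠ 0) ∧ (∃ y ∈ Y, s y ≠ 0) ∧
    (∀ x ∈ X, q x ≠ 0 → φ x ∈ Y ∧ s (φ x) ≠ 0 ∧ ψ (φ x) = x) ∧
    (∀ y ∈ Y, s y ≠ 0 → ψ y ∈ X ∧ q (ψ y) ≠ 0 ∧ φ (ψ y) = y) ∧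
    IsRegularOnOpen X q φ ∧ IsRegularOnOpen Y s ψ

section Localised

variable {E : Type*} [AddCommGroup E] [Module ℂ E]

/-- The points of `W` at which no functional from `Λ` vanishes. -/
def nonvanishing (Λ : Set (Dual ℂ E)) (W : Set E) : Set E :=
  {y | y ∈ W ∧ ∀ l ∈ Λ, l y ≠ 0}

/-- The localisation of the algebra of regular functions on the linear subspace `W` of `E` obtained
by inverting the linear functions in `Λ`, as an algebra of functions on the Zariski open subset of
`W` where these do not vanish: it is generated by linear functions and by the `1 / l`, `l ∈ Λ`. -/
def localizedFun (Λ : Set (Dual ℂ E)) (W : Set E) : Subalgebra ℂ (nonvanishing Λ W → ℂ) :=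
  Algebra.adjoin ℂ
    ({f | ∃ l : Dual ℂ E, ∀ y, f y = l (y : E)} ∪ {f | ∃ l ∈ Λ, ∀ y, f y = (l (y : E))⁻¹})

/-- The inclusion of the open part of `W` into the open part of the whole space. -/
def incl (Λ : Set (Dual ℂ E)) (W : Set E) (y : nonvanishing Λ W) : nonvanishing Λ Set.univ :=
  ⟨y, Set.mem_univ _, y.2.2⟩

/-- Extension of a function by zero. -/
def extendZero {U : Set E} (f : U → ℂ) : E → ℂ := Function.extend Subtype.val f 0

end Localised

/-! ### The semisimple Lie algebra, root vectors, coordinates -/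

section LieAlg

variable {L : Type*} [LieRing L] [LieAlgebra ℂ L] [FiniteDimensional ℂ L] [IsKilling ℂ L]
  {H : LieSubalgebra ℂ L} [H.IsCartanSubalgebra]

/-- The root `-α`. -/
def negRoot (α : H.root) : H.root :=
  ⟨-α.1, by simpa using (LieSubalgebra.isNonZero_coe_root α).neg⟩

variable (H) in
/-- A normalised choice of root vectors `e_α`, `α ∈ Δ`: `[e_α, e_{-α}]` is the coroot `h_α`
(so that also `[h_α, e_{±α}] = ±2 e_{±α}`). -/
structure RootVectors where
  /-- The root vector `e_α`. -/
  vec : H.root → L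
  vec_mem : ∀ α : H.root, vec α ∈ rootSpace H (α : Weight ℂ H L)
  lie_vec : ∀ α : H.root, ⁅vec α, vec (negRoot α)⁆ = (coroot (α : Weight ℂ H L) : L)

namespace RootVectors

variable (e : RootVectors H)

/-- The map `(h, c) ↦ h + ∑ c_α e_α`. -/
def assemble : (H × (H.root → ℂ)) →ₗ[ℂ] L :=
  LinearMap.coprod H.toSubmodule.subtype (Fintype.linearCombination ℂ e.vec)

theorem assemble_apply (p : H × (H.root → ℂ)) :
    e.assemble p = (p.1 : L) + ∑ α, p.2 α • e.vec α := by
  simp [assemble, Fintype.linearCombination_apply]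
  rfl

theorem killing_vec_ne_zero (α : H.root) :
    killingForm ℂ L (e.vec α) (e.vec (negRoot α)) ≠ 0 := by
  intro h0
  have h1 := lie_eq_killingForm_smul_of_mem_rootSpace_of_mem_rootSpace_neg
    (e.vec_mem α) (f := e.vec (negRoot α)) (e.vec_mem (negRoot α))
  rw [h0, zero_smul, e.lie_vec α] at h1
  have h2 : coroot (α : Weight ℂ H L) = 0 := by exact_mod_cast h1
  exact LieSubalgebra.isNonZero_coe_root α (coroot_eq_zero_iff.mp h2)

theorem vec_ne_zero (α : H.root) : e.vec α ≠ 0 := by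
  intro h0
  have := e.killing_vec_ne_zero α
  simp [h0] at this

theorem assemble_injective : Function.Injective e.assemble := by
  rw [← LinearMap.ker_eq_bot, LinearMap.ker_eq_bot']
  rintro ⟨h, c⟩ hp
  rw [assemble_apply] at hp
  have hc : c = 0 := by
    funext α
    have h1 := congrArg (fun z => killingForm ℂ L z (e.vec (negRoot α))) hp
    simp only [map_add, map_sum, map_smul, LinearMap.add_apply, LinearMap.sum_apply,
      LinearMap.smul_apply, map_zero, LinearMap.zero_apply] at h1
    have hα : (α : Weight ℂ H L).IsNonZero := LieSubalgebra.isNonZero_coe_root α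
    have h2 : killingForm ℂ L (h : L) (e.vec (negRoot α)) = 0 := by
      refine killingForm_apply_eq_zero_of_mem_rootSpace_of_add_ne_zero ℂ L H (α := 0)
        ?_ (e.vec_mem _) ?_
      · rw [rootSpace_zero_eq]; exact h.2
      · simpa [negRoot] using hα
    rw [h2, zero_add, Finset.sum_eq_single α] at h1
    · simpa [e.killing_vec_ne_zero α] using h1
    · intro β _ hβ
      rw [killingForm_apply_eq_zero_of_mem_rootSpace_of_add_ne_zero ℂ L H (e.vec_mem β) (e.vec_mem _),
        smul_zero]
      intro h3
      apply hβ
      apply Subtype.ext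
      apply DFunLike.coe_injective
      simpa [negRoot, ← sub_eq_add_neg, sub_eq_zero] using h3
    · simp
  subst hc
  simpa using hp

open Classical in
theorem assemble_surjective : Function.Surjective e.assemble := by
  rw [← LinearMap.range_eq_top, eq_top_iff, ← LieSubmodule.top_toSubmodule (R := ℂ) (L := H),
    ← iSup_genWeightSpace_eq_top' ℂ H L, LieSubmodule.iSup_toSubmodule, iSup_le_iff]
  intro χ x hx
  by_cases hχ : χ.IsZero
  · have hx' : x ∈ H := by
      have : x ∈ rootSpace H (χ : H → ℂ) := hx
      rw [hχ, rootSpace_zero_eq] at this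
      exact this
    exact ⟨(⟨x, hx'⟩, 0), by simp [assemble_apply]⟩
  · have hχ' : χ ∈ H.root := by simpa using hχ
    have h1 := finrank_rootSpace_eq_one χ hχ
    have h2 : (⟨e.vec ⟨χ, hχ'⟩, e.vec_mem ⟨χ, hχ'⟩⟩ : rootSpace H χ) ≠ 0 := by
      intro h
      exact e.vec_ne_zero ⟨χ, hχ'⟩ (congrArg Subtype.val h)
    obtain ⟨c, hc⟩ := (finrank_eq_one_iff_of_nonzero' _ h2).mp h1 ⟨x, hx⟩
    refine ⟨(0, Pi.single ⟨χ, hχ'⟩ c), ?_⟩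
    rw [assemble_apply]
    have h3 := congrArg Subtype.val hc
    simp only at h3
    rw [Finset.sum_eq_single ⟨χ, hχ'⟩]
    · simpa using h3
    · intro β _ hβ
      simp [Pi.single_eq_of_ne hβ]
    · simp

/-- The unique representation `y = h + ∑_{α ∈ Δ} c_α e_α` of the elements `y` of the Lie algebra,
as the linear isomorphism `y ↦ (h, c)`. -/
def coords : L ≃ₗ[ℂ] H × (H.root → ℂ) :=
  (LinearEquiv.ofBijective e.assemble ⟨e.assemble_injective, e.assemble_surjective⟩).symm

/-- The coordinate `c_α`. -/
def coeff (α : H.root) : Dual ℂ L :=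
  (LinearMap.proj α ∘ₗ LinearMap.snd ℂ H (H.root → ℂ)) ∘ₗ e.coords.toLinearMap

/-- The function `ê_α`, whose value at `y` is `c_{-α}`. -/
def eHat (α : H.root) : Dual ℂ L := e.coeff (negRoot α)

/-- The function `ĥ_α`, whose value at `y = h + ∑ c_α e_α` is `α(h)`. -/
def hHat (α : H.root) : Dual ℂ L :=
  ((α : Weight ℂ H L).toLinear ∘ₗ LinearMap.fst ℂ H (H.root → ℂ)) ∘ₗ e.coords.toLinearMap

end RootVectors

/-! ### Positive roots, Borel subalgebra, nilradical -/

variable (b : (rootSystem H).Base)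

/-- The set `Δ_+` of positive roots. -/
abbrev PosRoot := {α : H.root // b.IsPos α}

/-- The nilradical `𝔫 = ⨁_{α ∈ Δ_+} 𝔤_α` of the Borel subalgebra. -/
def borelNilradical : Submodule ℂ L :=
  ⨆ α : PosRoot b, (rootSpace H (α.1 : Weight ℂ H L)).toSubmodule

theorem lie_cartan_mem {h x : L} (hh : h ∈ H) (hx : x ∈ borelNilradical b) :
    ⁅h, x⁆ ∈ borelNilradical b := by
  induction hx using Submodule.iSup_induction' with
  | mem α x hx =>
    refine Submodule.mem_iSup_of_mem α ?_
    exact (rootSpace H (α.1 : Weight ℂ H L)).lie_mem (x := (⟨h, hh⟩ : H)) hx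
  | zero => simp
  | add x y _ _ hx hy => rw [lie_add]; exact add_mem hx hy

theorem lie_nil_mem {x y : L} (hx : x ∈ borelNilradical b) (hy : y ∈ borelNilradical b) :
    ⁅x, y⁆ ∈ borelNilradical b := by
  induction hx using Submodule.iSup_induction' with
  | mem α x hx =>
    induction hy using Submodule.iSup_induction' with
    | mem β y hy =>
      have hxy : ⁅x, y⁆ ∈ rootSpace H ((α.1 : Weight ℂ H L) + (β.1 : Weight ℂ H L) : H → ℂ) :=
        lie_mem_genWeightSpace_of_mem_genWeightSpace hx hy
      by_cases h0 : ⁅x, y⁆ = 0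
      · rw [h0]; exact zero_mem _
      have hne : rootSpace H ((α.1 : Weight ℂ H L) + (β.1 : Weight ℂ H L) : H → ℂ) ≠ ⊥ := by
        intro hbot
        rw [hbot] at hxy
        exact h0 (by simpa using hxy)
      let γ : Weight ℂ H L := ⟨_, hne⟩
      have hγ : γ.IsNonZero := by
        intro hz
        have h1 : (α.1 : Weight ℂ H L) = -(β.1 : Weight ℂ H L) := by
          apply DFunLike.coe_injective
          rw [Weight.coe_neg]
          exact eq_neg_of_add_eq_zero_left hz
        let := (rootSystem H).indexNeg
        have h2 : α.1 = -β.1 := by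
          apply (rootSystem H).root.injective
          rw [RootPairing.indexNeg_neg, RootPairing.root_reflectionPerm, RootPairing.reflection_apply_self]
          ext z
          simpa using DFunLike.congr_fun h1 z
        have h3 := α.2
        rw [h2] at h3
        exact (RootPairing.Base.IsPos.neg_iff_not b β.1).mp h3 β.2
      have hγ' : γ ∈ H.root := by simpa using hγ
      have hp : b.IsPos ⟨γ, hγ'⟩ :=
        RootPairing.Base.IsPos.add α.2 β.2 (by ext z; simp [γ])
      exact Submodule.mem_iSup_of_mem (⟨⟨γ, hγ'⟩, hp⟩ : PosRoot b) hxy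
    | zero => simp
    | add y z _ _ hy hz => rw [lie_add]; exact add_mem hy hz
  | zero => simp
  | add x z _ _ hx hz => rw [add_lie]; exact add_mem hx hz

/-- The Borel subalgebra `𝔟 = 𝔥 ⊕ ⨁_{α ∈ Δ_+} 𝔤_α` determined by the choice of positive roots. -/
def borel : LieSubalgebra ℂ L where
  toSubmodule := H.toSubmodule ⊔ borelNilradical b
  lie_mem' := by
    intro x y hx hy
    obtain ⟨h, hh, n, hn, rfl⟩ := Submodule.mem_sup.mp hx
    obtain ⟨h', hh', n', hn', rfl⟩ := Submodule.mem_sup.mp hy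
    have e1 : ⁅h + n, h' + n'⁆ = ⁅h, h'⁆ + (⁅h, n'⁆ - ⁅h', n⁆ + ⁅n, n'⁆) := by
      rw [add_lie, lie_add, lie_add, ← lie_skew n h']; abel
    rw [e1]
    exact Submodule.add_mem_sup (H.lie_mem hh hh')
      (add_mem (sub_mem (lie_cartan_mem b hh hn') (lie_cartan_mem b hh' hn)) (lie_nil_mem b hn hn'))

/-- The linear functions `ĥ_α`, `α ∈ Δ_+`. -/
def posFunctionals (e : RootVectors H) : Set (Dual ℂ L) := {l | ∃ α : PosRoot b, l = e.hHat α.1}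

/-- `𝔟' = 𝔥' + 𝔫`. -/
abbrev borelReg (e : RootVectors H) : Set L := nonvanishing (posFunctionals b e) (borel b : Set L)

/-- `𝔥'`, the set of `h ∈ 𝔥` with `α(h) ≠ 0` for all positive roots. -/
abbrev cartanReg (e : RootVectors H) : Set L := nonvanishing (posFunctionals b e) (H : Set L)

/-- The open subset `𝔤'` of `𝔤` on which the elements of `ℂ[𝔤]'` are functions. -/
abbrev lieReg (e : RootVectors H) : Set L := nonvanishing (posFunctionals b e) Set.univ

/-- `ℂ[𝔟]' = ℂ[𝔟] ⊗_{ℂ[𝔥]} ℂ[𝔥]'`. -/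
abbrev borelFun (e : RootVectors H) : Subalgebra ℂ (borelReg b e → ℂ) :=
  localizedFun (posFunctionals b e) (borel b : Set L)

/-- `ℂ[𝔤]' = ℂ[𝔤] ⊗_{ℂ[𝔥]} ℂ[𝔥]'`. -/
abbrev lieFun (e : RootVectors H) : Subalgebra ℂ (lieReg b e → ℂ) :=
  localizedFun (posFunctionals b e) Set.univ

/-- An enumeration `β_1, …, β_m` of `Δ_+` (here indexed by `0, …, m - 1`) is a normal ordering if,
whenever `γ = α + β` with `α, β, γ ∈ Δ_+`, the root `γ` is situated between `α` and `β`. -/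
def IsNormalOrdering {m : ℕ} (β : Fin m ≃ PosRoot b) : Prop :=
  ∀ i j k : Fin m,
    (rootSystem H).root (β k).1 = (rootSystem H).root (β i).1 + (rootSystem H).root (β j).1 →
    (i < k ∧ k < j) ∨ (j < k ∧ k < i)

/-! ### The Kirillov–Kostant Poisson bracket -/

/-- The gradient at `y`, with respect to the form `κ`, of a function on an open subset: the vector
`v` for which `κ v w` is the derivative in direction `w`, for all `w`. -/
def formGradient {U : Set L} (κ : LinearMap.BilinForm ℂ L) (hκ : κ.Nondegenerate) (φ : U → ℂ)
    (y : L) : L :=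
  ∑ i, lineDeriv ℂ (extendZero φ) y (finBasis ℂ L i) • κ.dualBasis hκ (finBasis ℂ L) i

/-- The Kirillov–Kostant bracket `{φ, ψ}(ξ) = ξ([dφ(ξ), dψ(ξ)])` on the dual of the Lie algebra,
transported to the Lie algebra by means of `κ`. -/
def poisson {U : Set L} (κ : LinearMap.BilinForm ℂ L) (hκ : κ.Nondegenerate) (φ ψ : U → ℂ) :
    U → ℂ :=
  fun y => κ y ⁅formGradient κ hκ φ y, formGradient κ hκ ψ y⁆

/-- `κ` is a symmetric invariant form, normalised so that `{ê_α, ê_{-α}} = ĥ_α` and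
`{ĥ_α, ê_{±α}} = ±2 ê_{±α}`. -/
structure IsNormalizedForm (e : RootVectors H) (α : PosRoot b) (κ : LinearMap.BilinForm ℂ L)
    (hκ : κ.Nondegenerate) : Prop where
  symm : ∀ x y, κ x y = κ y x
  invariant : ∀ x y z, κ ⁅x, y⁆ z = κ x ⁅y, z⁆
  bracket_e_e : ∀ y : lieReg b e,
    poisson κ hκ (fun z : lieReg b e => e.eHat α.1 z) (fun z => e.eHat (negRoot α.1) z) y =
      e.hHat α.1 y
  bracket_h_e : ∀ y : lieReg b e,
    poisson κ hκ (fun z : lieReg b e => e.hHat α.1 z) (fun z => e.eHat α.1 z) y =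
      2 * e.eHat α.1 y
  bracket_h_f : ∀ y : lieReg b e,
    poisson κ hκ (fun z : lieReg b e => e.hHat α.1 z) (fun z => e.eHat (negRoot α.1) z) y =
      -2 * e.eHat (negRoot α.1) y

/-! ### The group `N`, its adjoint action, invariants

A complex semisimple algebraic group with Lie algebra `L` is realised as a subgroup of `GL(V)`,
where `V` is a faithful finite-dimensional `L`-module. -/

variable (V : Type*) [AddCommGroup V] [Module ℂ V] [LieRingModule L V] [LieModule ℂ L V]

/-- The exponential of a nilpotent endomorphism. -/
def nilExp {V : Type*} [AddCommGroup V] [Module ℂ V] (a : Module.End ℂ V) : Module.End ℂ V :=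
  ∑ k ∈ Finset.range (nilpotencyClass a), (k.factorial : ℂ)⁻¹ • a ^ k

/-- The unipotent subgroup `N` of the group, corresponding to the nilradical `𝔫`. -/
def unipotent : Subgroup (Module.End ℂ V)ˣ :=
  Subgroup.closure {g | ∃ x ∈ borelNilradical b, (g : Module.End ℂ V) = nilExp (toEnd ℂ L V x)}

/-- The points of `N`, as a subvariety of `End V`. -/
def unipotentPoints : Set (Module.End ℂ V) := Units.val '' (unipotent b V : Set (Module.End ℂ V)ˣ)

variable {V} in
/-- The adjoint action: `Ad g y` is the element of the Lie algebra which acts on the faithful module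
`V` as `g y g⁻¹`. -/
def Ad (g : Module.End ℂ V) (y : L) : L :=
  Function.invFun (toEnd ℂ L V) (g * toEnd ℂ L V y * Ring.inverse g)

/-- `f` is invariant under the action of `N` on functions on `𝔟'`. -/
def IsInvariant (e : RootVectors H) (f : borelReg b e → ℂ) : Prop :=
  ∀ g ∈ unipotentPoints b V, ∀ y : borelReg b e,
    ∃ hy : Ad g (y : L) ∈ borelReg b e, f ⟨Ad g (y : L), hy⟩ = f y

/-- `P` is the projection operator corresponding to the isomorphism `N × 𝔥' → 𝔟'`,
`(g, x) ↦ Ad g x`, that is, `(P f)(Ad g x) = f(x)`. -/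
def IsProjectionOperator (e : RootVectors H) (P : Module.End ℂ (borelFun b e)) : Prop :=
  ∀ f : borelFun b e, ∀ g ∈ unipotentPoints b V, ∀ x ∈ cartanReg b e,
    ∃ (hx : x ∈ borelReg b e) (hy : Ad g x ∈ borelReg b e),
      (P f : borelReg b e → ℂ) ⟨Ad g x, hy⟩ = (f : borelReg b e → ℂ) ⟨x, hx⟩

/-- The element `exp ((c_α / α(h)) e_α)` of `N` attached to `y = h + ∑ c_γ e_γ`. -/
def rootElement (e : RootVectors H) (α : PosRoot b) (y : L) : Module.End ℂ V :=
  nilExp ((e.coeff α.1 y / e.hHat α.1 y) • toEnd ℂ L V (e.vec α.1))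

/-- The action of `x ∈ 𝔫` on functions on `𝔟'`, induced by the action `(g f)(y) = f(g⁻¹ y)` of `N`:
`(x f)(y)` is the derivative of `f(Ad (exp (-t x)) y)` at `t = 0`. -/
def lieAct (e : RootVectors H) (x : L) (f : borelReg b e → ℂ) : borelReg b e → ℂ :=
  fun y => deriv (fun t : ℂ => extendZero f (Ad (nilExp (-t • toEnd ℂ L V x)) (y : L))) 0

end LieAlg

end QuasiClassical

end

noncomputable section

namespace QuasiClassical

/-! ### Exponentials of nilpotent endomorphisms -/

section NilExp

variable {V : Type*} [AddCommGroup V] [Module ℂ V]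

/-! Let `y ∈ 𝔟'` have Cartan part `h`, and put `t = c_α / α(h)`. Since `[e_α, h] = -α(h) e_α`,
applying `exp (t e_α)` cancels the term `c_α e_α` produced by `y` itself and leaves `h` unchanged;
otherwise it only creates terms at roots `γ + kα`, `k ≥ 1`, with `γ` among the roots present. Hence,
if the positive roots are treated in an order in which the current root plus a later one is again a
later one, a coordinate once removed never returns (`elim_sub_cartanProj_mem`), and `y` ends at `h`.
Increasing height is such an order, and so is every reversed normal ordering. This is the
factorisation of `P`. Multiplying the inverses of the group elements used gives an element of `N`,
depending regularly on `y`, which carries `h` back to `y` (`exists_unipotent_section`): the action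
map is surjective onto `𝔟'` and has a regular inverse there.

For injectivity, `Ad g` preserves the Cartan part, so it suffices that regular `x ∈ 𝔥'` have trivial
stabilisers. Choose `h₀ ∈ 𝔥` on which every root takes its height. Every `g ∈ N` is `1` plus
eigenvectors of `[h₀, -]` in `End V` with positive eigenvalues (`sub_one_mem_raising`). If `g` fixes
`x`, then `Ad g h₀` commutes with `x`, so it lies in `𝔥`; it also lies in `h₀ + 𝔫`, so it is `h₀`.
Thus `g - 1` commutes with `h₀` and vanishes (`eq_one_of_Ad_eq_self`).

`P` is the pullback along `y ↦ h`, hence an algebra homomorphism. That `f - P f` lies in the ideal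
of the nilpotent coordinates can be checked on generators of the algebra (`sub_projHom_mem`), and
this gives the kernel.

Along `t ↦ exp (-t e_α) y` linear functions are polynomial in `t` and the inverted functions are
constant, so every `f` in the algebra is polynomial. As `e_α` acts by `d/dt`, the series for `P_α`
is Taylor's formula (`exists_elimHom_series`). The normalisation of `κ` means `κ(e_α, e_{-α}) = 1`,
so `ê_α` has gradient `e_α` and `{ê_α, ψ}(y) = dψ([y, e_α])`. This is the derivative along the same
flow, which preserves `𝔟'`; so brackets restrict to the action of `e_α` (`poisson_eHat_incl`). -/

/-- Any exponent that kills `a` may replace the nilpotency class. One exponent can then serve a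
whole family, such as all multiples `t • a`, and the exponential becomes polynomial in the
parameter. -/
theorem nilExp_eq_sum {a : Module.End ℂ V} {k : ℕ} (h : a ^ k = 0) :
    nilExp a = ∑ i ∈ Finset.range k, (i.factorial : ℂ)⁻¹ • a ^ i := by
  have hle : nilpotencyClass a ≤ k := csInf_le' h
  rw [nilExp, ← Finset.sum_range_add_sum_Ico (fun i => (i.factorial : ℂ)⁻¹ • a ^ i) hle,
    left_eq_add]
  refine Finset.sum_eq_zero fun i hi => ?_
  rw [pow_eq_zero_of_le (Finset.mem_Ico.1 hi).1 (pow_nilpotencyClass ⟨k, h⟩), smul_zero]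

theorem nilExp_apply {a : Module.End ℂ V} {k : ℕ} (h : a ^ k = 0) (v : V) :
    nilExp a v = ∑ i ∈ Finset.range k, (i.factorial : ℂ)⁻¹ • (a ^ i) v := by
  simp [nilExp_eq_sum h]

theorem nilExp_smul_apply {a : Module.End ℂ V} {k : ℕ} (h : a ^ k = 0) (t : ℂ) (v : V) :
    nilExp (t • a) v = ∑ i ∈ Finset.range k, t ^ i • (i.factorial : ℂ)⁻¹ • (a ^ i) v := by
  rw [nilExp_apply (k := k) (by rw [smul_pow, h, smul_zero])]
  refine Finset.sum_congr rfl fun i _ => ?_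
  rw [smul_pow, LinearMap.smul_apply, smul_comm]

@[simp]
theorem nilExp_zero : nilExp (0 : Module.End ℂ V) = 1 := by
  simp [nilExp_eq_sum (pow_one (0 : Module.End ℂ V))]

theorem nilExp_add_of_commute {a c : Module.End ℂ V} (h : Commute a c) (ha : IsNilpotent a)
    (hc : IsNilpotent c) : nilExp (a + c) = nilExp a * nilExp c := by
  -- Restricting scalars to `ℚ` identifies the sum term by term with `IsNilpotent.exp`, whose
  -- addition formula is available.
  let _ : Module ℚ (Module.End ℂ V) := Module.compHom _ (algebraMap ℚ ℂ)
  have key : ∀ x : Module.End ℂ V, nilExp x = IsNilpotent.exp x := by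
    intro x
    refine Finset.sum_congr rfl fun i _ => ?_
    change _ = (algebraMap ℚ ℂ (i.factorial : ℚ)⁻¹) • x ^ i
    simp
  simpa only [key] using IsNilpotent.exp_add_of_commute h ha hc

theorem nilExp_mul_nilExp_neg {a : Module.End ℂ V} (ha : IsNilpotent a) :
    nilExp a * nilExp (-a) = 1 := by
  rw [← nilExp_add_of_commute (Commute.refl a).neg_right ha ha.neg, add_neg_cancel, nilExp_zero]

theorem nilExp_neg_mul_nilExp {a : Module.End ℂ V} (ha : IsNilpotent a) :
    nilExp (-a) * nilExp a = 1 := by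
  simpa using nilExp_mul_nilExp_neg ha.neg

/-- The exponential of a nilpotent endomorphism as a unit. -/
def nilExpUnit (a : Module.End ℂ V) (ha : IsNilpotent a) : (Module.End ℂ V)ˣ :=
  ⟨nilExp a, nilExp (-a), nilExp_mul_nilExp_neg ha, nilExp_neg_mul_nilExp ha⟩

theorem nilExp_mulLeft {a : Module.End ℂ V} (ha : IsNilpotent a) :
    nilExp (LinearMap.mulLeft ℂ a) = LinearMap.mulLeft ℂ (nilExp a) := by
  obtain ⟨k, hk⟩ := ha
  have h : LinearMap.mulLeft ℂ a ^ k = 0 := by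
    rw [LinearMap.pow_mulLeft, hk, LinearMap.mulLeft_zero_eq_zero]
  ext1 x
  simp [nilExp_apply h, nilExp_eq_sum hk, Finset.sum_mul, LinearMap.pow_mulLeft]

theorem nilExp_mulRight {a : Module.End ℂ V} (ha : IsNilpotent a) :
    nilExp (LinearMap.mulRight ℂ a) = LinearMap.mulRight ℂ (nilExp a) := by
  obtain ⟨k, hk⟩ := ha
  have h : LinearMap.mulRight ℂ a ^ k = 0 := by
    rw [LinearMap.pow_mulRight, hk, LinearMap.mulRight_zero_eq_zero]
  ext1 x
  simp [nilExp_apply h, nilExp_eq_sum hk, Finset.mul_sum, LinearMap.pow_mulRight]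

theorem isNilpotent_mulLeft_sub_mulRight {a : Module.End ℂ V} (ha : IsNilpotent a) :
    IsNilpotent (LinearMap.mulLeft ℂ a - LinearMap.mulRight ℂ a) := by
  refine Commute.isNilpotent_sub (LinearMap.commute_mulLeft_right (R := ℂ) a a) ?_ ?_
  · obtain ⟨k, hk⟩ := ha
    exact ⟨k, by rw [LinearMap.pow_mulLeft, hk, LinearMap.mulLeft_zero_eq_zero]⟩
  · obtain ⟨k, hk⟩ := ha
    exact ⟨k, by rw [LinearMap.pow_mulRight, hk, LinearMap.mulRight_zero_eq_zero]⟩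

/-- Left and right multiplications commute, so the exponential of `x ↦ a x - x a` factors as left
multiplication by `exp a` and right multiplication by `exp (-a)`. -/
theorem nilExp_conj {a : Module.End ℂ V} (ha : IsNilpotent a) (x : Module.End ℂ V) :
    nilExp a * x * nilExp (-a) = nilExp (LinearMap.mulLeft ℂ a - LinearMap.mulRight ℂ a) x := by
  have hl : IsNilpotent (LinearMap.mulLeft ℂ a) := by
    obtain ⟨k, hk⟩ := ha
    exact ⟨k, by rw [LinearMap.pow_mulLeft, hk, LinearMap.mulLeft_zero_eq_zero]⟩
  have hr : IsNilpotent (LinearMap.mulRight ℂ (-a)) := by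
    obtain ⟨k, hk⟩ := ha.neg
    exact ⟨k, by rw [LinearMap.pow_mulRight, hk, LinearMap.mulRight_zero_eq_zero]⟩
  have h : LinearMap.mulLeft ℂ a - LinearMap.mulRight ℂ a =
      LinearMap.mulLeft ℂ a + LinearMap.mulRight ℂ (-a) := by
    ext1 x; simp [sub_eq_add_neg]
  rw [h, nilExp_add_of_commute (LinearMap.commute_mulLeft_right (R := ℂ) a (-a)) hl hr,
    nilExp_mulLeft ha, nilExp_mulRight ha.neg]
  simp [mul_assoc]

theorem nilExp_intertwine {W : Type*} [AddCommGroup W] [Module ℂ W] {a : Module.End ℂ V}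
    {c : Module.End ℂ W} (φ : V →ₗ[ℂ] W) (ha : IsNilpotent a) (hc : IsNilpotent c)
    (h : ∀ v, φ (a v) = c (φ v)) (v : V) : φ (nilExp a v) = nilExp c (φ v) := by
  obtain ⟨k, hk⟩ := ha
  obtain ⟨l, hl⟩ := hc
  have hpow : ∀ i : ℕ, φ ((a ^ i) v) = (c ^ i) (φ v) := by
    intro i
    induction i with
    | zero => simp
    | succ i ih => rw [pow_succ', pow_succ', Module.End.mul_apply, Module.End.mul_apply, h, ih]
  rw [nilExp_apply (pow_eq_zero_of_le (le_max_left k l) hk),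
    nilExp_apply (pow_eq_zero_of_le (le_max_right k l) hl), map_sum]
  simp [hpow]

end NilExp

/-! ### Conjugation in a faithful module and the adjoint action -/

section Faithful

variable {L : Type*} [LieRing L] [LieAlgebra ℂ L]
  {V : Type*} [AddCommGroup V] [Module ℂ V] [LieRingModule L V] [LieModule ℂ L V]

variable (L V) in
/-- The representation on `V` as a linear map. -/
def rep : L →ₗ[ℂ] Module.End ℂ V where
  toFun x := toEnd ℂ L V x
  map_add' x y := by ext v; simp
  map_smul' c x := by ext v; simp

theorem rep_apply (x : L) : rep L V x = toEnd ℂ L V x := rfl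

theorem toEnd_lie (x y : L) : toEnd ℂ L V ⁅x, y⁆ =
    toEnd ℂ L V x * toEnd ℂ L V y - toEnd ℂ L V y * toEnd ℂ L V x := by
  ext v
  simp

theorem toEnd_lie_pow (z y : L) (i : ℕ) :
    toEnd ℂ L V ((ad ℂ L z ^ i) y) =
      ((LinearMap.mulLeft ℂ (toEnd ℂ L V z) - LinearMap.mulRight ℂ (toEnd ℂ L V z)) ^ i)
        (toEnd ℂ L V y) := by
  induction i with
  | zero => simp
  | succ i ih =>
    rw [pow_succ', pow_succ', Module.End.mul_apply, Module.End.mul_apply, ← ih, ad_apply,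
      toEnd_lie]
    simp

variable [LieModule.IsFaithful ℂ L V]

theorem toEnd_inj {x y : L} : toEnd ℂ L V x = toEnd ℂ L V y ↔ x = y :=
  (LieModule.IsFaithful.injective_toEnd (R := ℂ) (L := L) (M := V)).eq_iff

variable (L V) in
-- A linear retraction of `End V` onto the Lie algebra makes `Ad g y` a linear function of `g y
-- g⁻¹`; this is used to show that the action map is polynomial.
theorem exists_leftInverse_rep : ∃ σ : Module.End ℂ V →ₗ[ℂ] L, ∀ x, σ (toEnd ℂ L V x) = x := by
  obtain ⟨σ, hσ⟩ := (rep L V).exists_leftInverse_of_injective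
    (LinearMap.ker_eq_bot.mpr (LieModule.IsFaithful.injective_toEnd (R := ℂ) (L := L) (M := V)))
  exact ⟨σ, fun x => LinearMap.congr_fun hσ x⟩

theorem isNilpotent_ad_of_toEnd {z : L} (hz : IsNilpotent (toEnd ℂ L V z)) :
    IsNilpotent (ad ℂ L z) := by
  obtain ⟨k, hk⟩ := isNilpotent_mulLeft_sub_mulRight hz
  refine ⟨k, LinearMap.ext fun y => ?_⟩
  rw [← toEnd_inj (V := V), toEnd_lie_pow, hk]
  simp

theorem nilExp_conj_toEnd {z : L} (hz : IsNilpotent (toEnd ℂ L V z)) (y : L) :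
    nilExp (toEnd ℂ L V z) * toEnd ℂ L V y * nilExp (-toEnd ℂ L V z) =
      toEnd ℂ L V (nilExp (ad ℂ L z) y) := by
  rw [nilExp_conj hz]
  refine (nilExp_intertwine (rep L V) (isNilpotent_ad_of_toEnd hz)
    (isNilpotent_mulLeft_sub_mulRight hz) (fun v => ?_) y).symm
  simpa [rep_apply] using toEnd_lie_pow (V := V) z v 1

/-- `Ad` is defined by `Function.invFun`, so it is meaningful only when the conjugate lies in the
image of the Lie algebra. An explicit `y'` with `g y = y' g` certifies this, and no inverse has to
be handled. -/
theorem Ad_eq {g : (Module.End ℂ V)ˣ} {y y' : L}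
    (h : (g : Module.End ℂ V) * toEnd ℂ L V y = toEnd ℂ L V y' * g) :
    Ad (g : Module.End ℂ V) y = y' := by
  have hinj := LieModule.IsFaithful.injective_toEnd (R := ℂ) (L := L) (M := V)
  rw [Ad, h, Ring.inverse_unit, mul_assoc, Units.mul_inv, mul_one]
  exact Function.leftInverse_invFun hinj y'

theorem Ad_nilExp {z : L} (hz : IsNilpotent (toEnd ℂ L V z)) (y : L) :
    Ad (nilExp (toEnd ℂ L V z)) y = nilExp (ad ℂ L z) y := by
  refine Ad_eq (g := nilExpUnit _ hz) ?_
  rw [← nilExp_conj_toEnd hz]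
  simp [nilExpUnit, mul_assoc, nilExp_neg_mul_nilExp hz]

end Faithful

/-! ### Elements of positive degree for an inner derivation -/

section Raising

variable {A : Type*} [Ring A] [Algebra ℂ A]

/-- The sum of the eigenspaces of `[a, -]` for the integral eigenvalues `j ≥ k`. -/
def raising (a : A) (k : ℕ) : Submodule ℂ A :=
  ⨆ j : {j : ℕ // k ≤ j},
    Module.End.eigenspace (LinearMap.mulLeft ℂ a - LinearMap.mulRight ℂ a) (j : ℂ)

theorem mem_raising {a x : A} {j k : ℕ} (hjk : k ≤ j) (h : a * x - x * a = (j : ℂ) • x) :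
    x ∈ raising a k :=
  Submodule.mem_iSup_of_mem (⟨j, hjk⟩ : {j : ℕ // k ≤ j})
    (Module.End.mem_eigenspace_iff.mpr (by simpa using h))

theorem raising_mul_mem {a x y : A} {k l : ℕ} (hx : x ∈ raising a k) (hy : y ∈ raising a l) :
    x * y ∈ raising a (k + l) := by
  induction hx using Submodule.iSup_induction' with
  | mem i x hx =>
    induction hy using Submodule.iSup_induction' with
    | mem j y hy =>
      refine mem_raising (j := i + j) (add_le_add i.2 j.2) ?_
      have h1 := Module.End.mem_eigenspace_iff.mp hx
      have h2 := Module.End.mem_eigenspace_iff.mp hy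
      simp only [LinearMap.sub_apply, LinearMap.mulLeft_apply, LinearMap.mulRight_apply] at h1 h2
      have : a * (x * y) - x * y * a = (a * x - x * a) * y + x * (a * y - y * a) := by noncomm_ring
      rw [this, h1, h2]
      push_cast
      rw [add_smul, smul_mul_assoc, mul_smul_comm]
    | zero => simp
    | add y z _ _ hy hz => rw [mul_add]; exact add_mem hy hz
  | zero => simp
  | add x z _ _ hx hz => rw [add_mul]; exact add_mem hx hz

theorem raising_mono (a : A) {k l : ℕ} (h : k ≤ l) : raising a l ≤ raising a k :=
  iSup_le fun j => le_iSup_of_le (⟨j, h.trans j.2⟩ : {j : ℕ // k ≤ j}) le_rfl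

theorem raising_pow_mem {a x : A} (hx : x ∈ raising a 1) (k : ℕ) :
    x ^ (k + 1) ∈ raising a (k + 1) := by
  induction k with
  | zero => simpa using hx
  | succ k ih => rw [pow_succ]; exact raising_mul_mem ih hx

/-- The operator `[a, -]` on a finite-dimensional space has only finitely many eigenvalues. -/
theorem exists_raising_eq_bot [FiniteDimensional ℂ A] (a : A) : ∃ k, raising a (k + 1) = ⊥ := by
  set D := LinearMap.mulLeft ℂ a - LinearMap.mulRight ℂ a with hD
  have hfin : {j : ℕ | Module.End.HasEigenvalue D (j : ℂ)}.Finite :=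
    (Module.End.finite_hasEigenvalue D).preimage (Nat.cast_injective.injOn)
  obtain ⟨k, hk⟩ := hfin.bddAbove
  refine ⟨k, (iSup_eq_bot).mpr fun j => ?_⟩
  by_contra hne
  have := hk (a := (j : ℕ)) hne
  have := j.2
  omega

/-- Degrees add under multiplication, so a high power would have a degree beyond the largest
eigenvalue. The exponent depends on `a` only, not on `x`. -/
theorem exists_pow_eq_zero_of_raising [FiniteDimensional ℂ A] (a : A) :
    ∃ k, ∀ x ∈ raising a 1, x ^ (k + 1) = 0 := by
  obtain ⟨k, hk⟩ := exists_raising_eq_bot a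
  exact ⟨k, fun x hx => by simpa [hk] using raising_pow_mem hx k⟩

/-- Commuting with `a` means degree `0`, and eigenspaces for different eigenvalues are independent.
-/
theorem eq_zero_of_mem_raising_of_commute {a x : A} (hx : x ∈ raising a 1) (h : a * x = x * a) :
    x = 0 := by
  set D := LinearMap.mulLeft ℂ a - LinearMap.mulRight ℂ a with hD
  have h1 := (Module.End.eigenspaces_iSupIndep D) 0
  refine Submodule.disjoint_def.mp h1 x ?_ ?_
  · rw [Module.End.mem_eigenspace_iff]; simp [hD, h]
  · refine (iSup_le fun j => ?_ : raising a 1 ≤ _) hx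
    refine le_iSup₂_of_le (j : ℂ) ?_ le_rfl
    have := j.2
    exact_mod_cast (by omega : (j : ℕ) ≠ 0)

end Raising

section LieAlg

variable {L : Type*} [LieRing L] [LieAlgebra ℂ L] [FiniteDimensional ℂ L] [IsKilling ℂ L]
  {H : LieSubalgebra ℂ L} [H.IsCartanSubalgebra]

/-! ### Coordinates -/

@[simp]
theorem negRoot_negRoot (α : H.root) : negRoot (negRoot α) = α :=
  Subtype.ext (neg_neg α.1)

/-- The simple roots form a basis of the dual of `𝔥`, so some functional on that dual is `1` on each
of them; by reflexivity it is evaluation at an element of `𝔥`. -/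
theorem exists_height_element (b : (rootSystem H).Base) :
    ∃ h : H, ∀ α : H.root, (α : Weight ℂ H L) h = (b.height α : ℂ) := by
  obtain ⟨h, hh⟩ := (Module.evalEquiv ℂ H).surjective
    (b.toWeightBasis.constr ℂ (fun _ => (1 : ℂ)))
  refine ⟨h, fun α => ?_⟩
  obtain ⟨f, -, -, hf⟩ := b.exists_root_eq_sum_int α
  rw [RootPairing.Base.height_eq_sum hf]
  have h1 : ∀ l : Dual ℂ H, l h = b.toWeightBasis.constr ℂ (fun _ => (1 : ℂ)) l := by
    intro l
    rw [← hh]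
    rfl
  have h2 : (α : Weight ℂ H L) h = ((rootSystem H).root α) h := rfl
  rw [h2, h1, hf, map_sum]
  push_cast
  refine Finset.sum_congr rfl fun j hj => ?_
  have h3 : b.toWeightBasis.constr ℂ (fun _ => (1 : ℂ)) ((rootSystem H).root j) = 1 := by
    have := b.toWeightBasis.constr_basis ℂ (fun _ => (1 : ℂ)) ⟨j, hj⟩
    rwa [b.toWeightBasis_apply] at this
  rw [map_zsmul, h3, zsmul_eq_mul, mul_one]

namespace RootVectors

variable (e : RootVectors H)

/-- The projection onto the Cartan subalgebra along the root spaces. -/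
def cartanProj : L →ₗ[ℂ] L :=
  H.toSubmodule.subtype ∘ₗ LinearMap.fst ℂ H (H.root → ℂ) ∘ₗ e.coords.toLinearMap

theorem cartanProj_mem (y : L) : e.cartanProj y ∈ H := (e.coords y).1.2

theorem assemble_coords (y : L) : e.assemble (e.coords y) = y :=
  (LinearEquiv.ofBijective e.assemble
    ⟨e.assemble_injective, e.assemble_surjective⟩).apply_symm_apply y

theorem coords_assemble (p : H × (H.root → ℂ)) : e.coords (e.assemble p) = p :=
  (LinearEquiv.ofBijective e.assemble
    ⟨e.assemble_injective, e.assemble_surjective⟩).symm_apply_apply p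

theorem decomp (y : L) : y = e.cartanProj y + ∑ α, e.coeff α y • e.vec α := by
  conv_lhs => rw [← e.assemble_coords y, assemble_apply]
  rfl

theorem coords_of_mem {h : L} (hh : h ∈ H) : e.coords h = (⟨h, hh⟩, 0) := by
  rw [← e.coords_assemble (⟨h, hh⟩, 0)]
  simp [assemble_apply]

open Classical in
theorem coords_vec (α : H.root) : e.coords (e.vec α) = (0, Pi.single α 1) := by
  rw [← e.coords_assemble (0, Pi.single α 1), assemble_apply, Finset.sum_eq_single α]
  · simp
  · intro β _ hβ
    simp [Pi.single_eq_of_ne hβ]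
  · simp

theorem coeff_of_mem {h : L} (hh : h ∈ H) (α : H.root) : e.coeff α h = 0 := by
  simp [coeff, e.coords_of_mem hh]

theorem cartanProj_of_mem {h : L} (hh : h ∈ H) : e.cartanProj h = h := by
  simp [cartanProj, e.coords_of_mem hh]

theorem coeff_vec_self (α : H.root) : e.coeff α (e.vec α) = 1 := by
  simp [coeff, e.coords_vec α]

theorem coeff_vec_of_ne {α γ : H.root} (h : α ≠ γ) : e.coeff α (e.vec γ) = 0 := by
  classical
  simp [coeff, e.coords_vec γ, Pi.single_eq_of_ne h]

@[simp]
theorem cartanProj_vec (α : H.root) : e.cartanProj (e.vec α) = 0 := by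
  simp [cartanProj, e.coords_vec α]

theorem hHat_of_mem {h : L} (hh : h ∈ H) (α : H.root) :
    e.hHat α h = (α : Weight ℂ H L) ⟨h, hh⟩ := by
  simp [hHat, e.coords_of_mem hh]

@[simp]
theorem hHat_cartanProj (α : H.root) (y : L) : e.hHat α (e.cartanProj y) = e.hHat α y := by
  rw [e.hHat_of_mem (e.cartanProj_mem y)]
  rfl

theorem eHat_negRoot (α : H.root) : e.eHat (negRoot α) = e.coeff α := by
  rw [eHat, negRoot_negRoot]

theorem exists_smul_vec {α : H.root} {x : L} (hx : x ∈ rootSpace H (α : Weight ℂ H L)) :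
    ∃ c : ℂ, x = c • e.vec α := by
  have h1 := finrank_rootSpace_eq_one (α : Weight ℂ H L) (LieSubalgebra.isNonZero_coe_root α)
  have h2 : (⟨e.vec α, e.vec_mem α⟩ : rootSpace H (α : Weight ℂ H L)) ≠ 0 := by
    intro h
    exact e.vec_ne_zero α (congrArg Subtype.val h)
  obtain ⟨c, hc⟩ := (finrank_eq_one_iff_of_nonzero' _ h2).mp h1 ⟨x, hx⟩
  exact ⟨c, (congrArg Subtype.val hc).symm⟩

theorem lie_cartan_vec {h : L} (hh : h ∈ H) (α : H.root) :
    ⁅h, e.vec α⁆ = e.hHat α h • e.vec α := by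
  rw [e.hHat_of_mem hh]
  exact lie_eq_smul_of_mem_rootSpace (e.vec_mem α) ⟨h, hh⟩

theorem coeff_lie_cartan {h : L} (hh : h ∈ H) (α : H.root) (y : L) :
    e.coeff α ⁅h, y⁆ = e.hHat α h * e.coeff α y := by
  conv_lhs => rw [e.decomp y]
  have h0 : ⁅h, e.cartanProj y⁆ ∈ H := H.lie_mem hh (e.cartanProj_mem y)
  simp only [lie_add, lie_sum, lie_smul, e.lie_cartan_vec hh, map_add, map_sum, map_smul,
    e.coeff_of_mem h0, zero_add, smul_eq_mul]
  rw [Finset.sum_eq_single α]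
  · rw [e.coeff_vec_self]; ring
  · intro β _ hβ
    rw [e.coeff_vec_of_ne hβ.symm]; ring
  · simp

end RootVectors

/-! ### The Borel subalgebra in coordinates -/

variable (b : (rootSystem H).Base) (e : RootVectors H)

theorem vec_mem_nilradical (α : PosRoot b) : e.vec α.1 ∈ borelNilradical b :=
  Submodule.mem_iSup_of_mem α (e.vec_mem α.1)

variable {b}

theorem nilradical_le_borel {x : L} (hx : x ∈ borelNilradical b) : x ∈ borel b :=
  (le_sup_right : borelNilradical b ≤ H.toSubmodule ⊔ borelNilradical b) hx

theorem cartan_le_borel {x : L} (hx : x ∈ H) : x ∈ borel b :=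
  (le_sup_left : H.toSubmodule ≤ H.toSubmodule ⊔ borelNilradical b) hx

theorem nilradical_eq_span : borelNilradical b =
    Submodule.span ℂ (Set.range fun α : PosRoot b => e.vec α.1) := by
  refine le_antisymm (iSup_le fun α x hx => ?_) (Submodule.span_le.mpr ?_)
  · obtain ⟨c, rfl⟩ := e.exists_smul_vec hx
    exact Submodule.smul_mem _ _ (Submodule.subset_span ⟨α, rfl⟩)
  · rintro _ ⟨α, rfl⟩
    exact vec_mem_nilradical b e α

theorem cartanProj_of_mem_nilradical {x : L} (hx : x ∈ borelNilradical b) :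
    e.cartanProj x = 0 := by
  rw [nilradical_eq_span e] at hx
  induction hx using Submodule.span_induction with
  | mem x hx => obtain ⟨α, rfl⟩ := hx; simp
  | zero => simp
  | add x y _ _ hx hy => rw [map_add, hx, hy, add_zero]
  | smul c x _ hx => rw [map_smul, hx, smul_zero]

theorem coeff_of_mem_borel {y : L} (hy : y ∈ borel b) {α : H.root} (hα : ¬ b.IsPos α) :
    e.coeff α y = 0 := by
  obtain ⟨h, hh, x, hx, rfl⟩ := Submodule.mem_sup.mp hy
  rw [map_add, e.coeff_of_mem hh, zero_add]
  clear hy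
  rw [nilradical_eq_span e] at hx
  induction hx using Submodule.span_induction with
  | mem x hx =>
    obtain ⟨γ, rfl⟩ := hx
    refine e.coeff_vec_of_ne ?_
    rintro rfl
    exact hα γ.2
  | zero => simp
  | add x y _ _ hx hy => rw [map_add, hx, hy, add_zero]
  | smul c x _ hx => rw [map_smul, hx, smul_zero]

theorem sub_cartanProj_mem {y : L} (hy : y ∈ borel b) :
    y - e.cartanProj y ∈ borelNilradical b := by
  obtain ⟨h, hh, x, hx, rfl⟩ := Submodule.mem_sup.mp hy
  rw [map_add, e.cartanProj_of_mem hh, cartanProj_of_mem_nilradical e hx]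
  simpa using hx

theorem hHat_of_mem_nilradical {x : L} (hx : x ∈ borelNilradical b) (α : H.root) :
    e.hHat α x = 0 := by
  rw [← e.hHat_cartanProj, cartanProj_of_mem_nilradical e hx, map_zero]

/-- Bracketing with `x` multiplies `c_α` by `α(x)`, which is nonzero for positive `α`; on `𝔟` the
remaining root coordinates are zero anyway. -/
theorem mem_cartan_of_lie_eq_zero {x z : L} (hx : x ∈ cartanReg b e) (hz : z ∈ borel b)
    (h : ⁅x, z⁆ = 0) : z ∈ H := by
  have hc : ∀ α : H.root, e.coeff α z = 0 := by
    intro α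
    by_cases hα : b.IsPos α
    · have h1 := e.coeff_lie_cartan hx.1 α z
      rw [h, map_zero] at h1
      exact (mul_eq_zero.mp h1.symm).resolve_left (hx.2 _ ⟨⟨α, hα⟩, rfl⟩)
    · exact coeff_of_mem_borel e hz hα
  rw [e.decomp z]
  simpa [hc] using e.cartanProj_mem z

theorem eq_of_sub_mem_nilradical {x y : L} (hx : x ∈ H) (hy : y ∈ H)
    (h : x - y ∈ borelNilradical b) (e : RootVectors H) : x = y := by
  have := cartanProj_of_mem_nilradical e h
  rwa [map_sub, e.cartanProj_of_mem hx, e.cartanProj_of_mem hy, sub_eq_zero] at this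

theorem lie_nilradical_borel {x y : L} (hx : x ∈ borelNilradical b) (hy : y ∈ borel b) :
    ⁅x, y⁆ ∈ borelNilradical b := by
  obtain ⟨h, hh, n, hn, rfl⟩ := Submodule.mem_sup.mp hy
  rw [lie_add, ← lie_skew x h]
  exact add_mem (neg_mem (lie_cartan_mem b hh hx)) (lie_nil_mem b hx hn)

theorem nilExp_ad_sub_mem {x y : L} (hx : x ∈ borelNilradical b) (hn : IsNilpotent (ad ℂ L x))
    (hy : y ∈ borel b) : nilExp (ad ℂ L x) y - y ∈ borelNilradical b := by
  obtain ⟨k, hk⟩ := hn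
  have hpow : ∀ i, (ad ℂ L x ^ (i + 1)) y ∈ borelNilradical b := by
    intro i
    induction i with
    | zero => simpa using lie_nilradical_borel hx hy
    | succ i ih =>
      rw [pow_succ', Module.End.mul_apply, ad_apply]
      exact lie_nil_mem b hx ih
  rw [nilExp_apply (k := k + 1) (by rw [pow_succ, hk, zero_mul]), Finset.sum_range_succ']
  simp only [Nat.factorial_zero, pow_zero, Nat.cast_one, inv_one, one_smul, Module.End.one_apply,
    add_sub_cancel_right]
  exact Submodule.sum_mem _ fun i _ => Submodule.smul_mem _ _ (hpow i)

theorem mem_borel_of_sub_mem {y y' : L} (hy : y ∈ borel b) (h : y' - y ∈ borelNilradical b) :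
    y' ∈ borel b := by
  have := add_mem (S := LieSubalgebra ℂ L) (nilradical_le_borel h) hy
  rwa [sub_add_cancel] at this

theorem mem_borelReg_of_sub_mem {y y' : L} (hy : y ∈ borelReg b e)
    (h : y' - y ∈ borelNilradical b) : y' ∈ borelReg b e := by
  refine ⟨mem_borel_of_sub_mem hy.1 h, ?_⟩
  rintro _ ⟨α, rfl⟩
  have h1 := hHat_of_mem_nilradical e h α.1
  rw [map_sub, sub_eq_zero] at h1
  rw [h1]
  exact hy.2 _ ⟨α, rfl⟩

theorem cartanReg_subset_borelReg {x : L} (hx : x ∈ cartanReg b e) : x ∈ borelReg b e :=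
  ⟨cartan_le_borel hx.1, hx.2⟩

theorem cartanProj_mem_cartanReg {y : L} (hy : y ∈ borelReg b e) :
    e.cartanProj y ∈ cartanReg b e := by
  refine ⟨e.cartanProj_mem y, ?_⟩
  rintro _ ⟨α, rfl⟩
  rw [e.hHat_cartanProj]
  exact hy.2 _ ⟨α, rfl⟩

theorem exists_mem_cartanReg (b : (rootSystem H).Base) (e : RootVectors H) :
    ∃ x, x ∈ cartanReg b e := by
  obtain ⟨h, hh⟩ := exists_height_element b
  refine ⟨h, h.2, ?_⟩
  rintro _ ⟨α, rfl⟩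
  rw [e.hHat_of_mem h.2, hh]
  exact_mod_cast b.height_ne_zero α.1

/-! ### The unipotent group -/

variable {V : Type*} [AddCommGroup V] [Module ℂ V] [LieRingModule L V] [LieModule ℂ L V]

/-- A root vector for a positive root is an eigenvector of `[h, -]` whose eigenvalue is the height
of that root. -/
theorem toEnd_mem_raising {h : H} (hh : ∀ α : H.root, (α : Weight ℂ H L) h = (b.height α : ℂ))
    {x : L} (hx : x ∈ borelNilradical b) :
    toEnd ℂ L V x ∈ raising (toEnd ℂ L V (h : L)) 1 := by
  induction hx using Submodule.iSup_induction' with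
  | mem α x hx =>
    have hpos : 0 < b.height α.1 := α.2
    refine mem_raising (j := (b.height α.1).toNat) (by omega) ?_
    rw [← toEnd_lie]
    have h1 : ⁅(h : L), x⁆ = (α.1 : Weight ℂ H L) h • x := lie_eq_smul_of_mem_rootSpace hx h
    rw [h1, hh]
    have h2 : ((b.height α.1).toNat : ℂ) = (b.height α.1 : ℂ) := by
      have : (((b.height α.1).toNat : ℤ)) = b.height α.1 := Int.toNat_of_nonneg hpos.le
      exact_mod_cast congrArg (Int.cast : ℤ → ℂ) this
    rw [h2]
    exact map_smul (rep L V) _ _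
  | zero => simp
  | add x y _ _ hx hy =>
    have : toEnd ℂ L V (x + y) = toEnd ℂ L V x + toEnd ℂ L V y := map_add (rep L V) x y
    rw [this]; exact add_mem hx hy

variable [FiniteDimensional ℂ V]

theorem isNilpotent_toEnd_of_mem_nilradical {x : L} (hx : x ∈ borelNilradical b) :
    IsNilpotent (toEnd ℂ L V x) := by
  obtain ⟨h, hh⟩ := exists_height_element b
  obtain ⟨k, hk⟩ := exists_pow_eq_zero_of_raising (toEnd ℂ L V (h : L))
  exact ⟨k + 1, hk _ (toEnd_mem_raising hh hx)⟩

theorem nilExp_sub_one_mem_raising {a x : Module.End ℂ V} (hx : x ∈ raising a 1) :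
    nilExp x - 1 ∈ raising a 1 := by
  obtain ⟨k, hk⟩ := exists_pow_eq_zero_of_raising a
  rw [nilExp_eq_sum (hk x hx), Finset.sum_range_succ']
  simp only [Nat.factorial_zero, pow_zero, Nat.cast_one, inv_one, one_smul, add_sub_cancel_right]
  exact Submodule.sum_mem _ fun i _ => Submodule.smul_mem _ _
    (raising_mono a (Nat.succ_le_succ (Nat.zero_le i)) (raising_pow_mem hx i))

/-- No case for inverses is needed, since the inverse of the generator `exp x` is the generator `exp
(-x)`. -/
theorem unipotent_induction {p : (Module.End ℂ V)ˣ → Prop} (one : p 1)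
    (mul : ∀ g k, p g → p k → p (g * k))
    (exp : ∀ x ∈ borelNilradical b, ∀ g : (Module.End ℂ V)ˣ,
      (g : Module.End ℂ V) = nilExp (toEnd ℂ L V x) → p g)
    {g : (Module.End ℂ V)ˣ} (hg : g ∈ unipotent b V) : p g := by
  refine Subgroup.closure_induction'' ?_ ?_ one (fun g k _ _ hg hk => mul g k hg hk) hg
  · rintro g ⟨x, hx, hgx⟩
    exact exp x hx g hgx
  · rintro g ⟨x, hx, hgx⟩
    have hn := isNilpotent_toEnd_of_mem_nilradical (V := V) hx
    refine exp (-x) (neg_mem hx) _ ?_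
    have : toEnd ℂ L V (-x) = -toEnd ℂ L V x := map_neg (rep L V) x
    rw [this, Units.inv_eq_of_mul_eq_one_right]
    rw [hgx, nilExp_mul_nilExp_neg hn]

theorem sub_one_mem_raising {h : H} (hh : ∀ α : H.root, (α : Weight ℂ H L) h = (b.height α : ℂ))
    {g : (Module.End ℂ V)ˣ} (hg : g ∈ unipotent b V) :
    (g : Module.End ℂ V) - 1 ∈ raising (toEnd ℂ L V (h : L)) 1 := by
  refine unipotent_induction (p := fun g => (g : Module.End ℂ V) - 1 ∈ raising _ 1) ?_ ?_ ?_ hg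
  · simp
  · intro g k hg hk
    have : ((g * k : (Module.End ℂ V)ˣ) : Module.End ℂ V) - 1 =
        ((g : Module.End ℂ V) - 1) * ((k : Module.End ℂ V) - 1) +
          (((g : Module.End ℂ V) - 1) + ((k : Module.End ℂ V) - 1)) := by
      rw [Units.val_mul]; noncomm_ring
    rw [this]
    exact add_mem (raising_mono _ (by omega) (raising_mul_mem hg hk)) (add_mem hg hk)
  · intro x hx g hgx
    rw [hgx]
    exact nilExp_sub_one_mem_raising (toEnd_mem_raising hh hx)

variable [LieModule.IsFaithful ℂ L V]

/-- For a generator take `y' = exp (ad x) y`, where every term after the first lies in `𝔫`. The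
property passes to products because `y'` is again in `𝔟`. -/
theorem exists_conj_of_mem_unipotent {g : (Module.End ℂ V)ˣ} (hg : g ∈ unipotent b V) :
    ∀ y ∈ borel b, ∃ y', y' - y ∈ borelNilradical b ∧
      (g : Module.End ℂ V) * toEnd ℂ L V y = toEnd ℂ L V y' * g := by
  refine unipotent_induction (p := fun g : (Module.End ℂ V)ˣ => ∀ y ∈ borel b, ∃ y', y' - y ∈ borelNilradical b ∧
      (g : Module.End ℂ V) * toEnd ℂ L V y = toEnd ℂ L V y' * (g : Module.End ℂ V)) ?_ ?_ ?_ hg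
  · intro y _
    exact ⟨y, by simp, by simp⟩
  · intro g k hg hk y hy
    obtain ⟨y', h1, h2⟩ := hk y hy
    obtain ⟨y'', h3, h4⟩ := hg y' (mem_borel_of_sub_mem hy h1)
    refine ⟨y'', by simpa using add_mem h3 h1, ?_⟩
    rw [Units.val_mul, mul_assoc, h2, ← mul_assoc, h4, mul_assoc]
  · intro x hx g hgx y hy
    have hn := isNilpotent_toEnd_of_mem_nilradical (V := V) hx
    refine ⟨nilExp (ad ℂ L x) y, nilExp_ad_sub_mem hx (isNilpotent_ad_of_toEnd hn) hy, ?_⟩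
    rw [hgx, ← nilExp_conj_toEnd hn]
    simp [mul_assoc, nilExp_neg_mul_nilExp hn]

theorem toEnd_Ad {g : (Module.End ℂ V)ˣ} (hg : g ∈ unipotent b V) {y : L} (hy : y ∈ borel b) :
    toEnd ℂ L V (Ad (g : Module.End ℂ V) y) * g = (g : Module.End ℂ V) * toEnd ℂ L V y := by
  obtain ⟨y', -, h⟩ := exists_conj_of_mem_unipotent hg y hy
  rw [Ad_eq h, h]

theorem Ad_sub_mem {g : Module.End ℂ V} (hg : g ∈ unipotentPoints b V) {y : L}
    (hy : y ∈ borel b) : Ad g y - y ∈ borelNilradical b := by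
  obtain ⟨g, hg, rfl⟩ := hg
  obtain ⟨y', h1, h⟩ := exists_conj_of_mem_unipotent hg y hy
  rwa [Ad_eq h]

theorem Ad_mul {g k : (Module.End ℂ V)ˣ} (hg : g ∈ unipotent b V) (hk : k ∈ unipotent b V) {y : L}
    (hy : y ∈ borel b) : Ad ((g : Module.End ℂ V) * (k : Module.End ℂ V)) y =
      Ad (g : Module.End ℂ V) (Ad (k : Module.End ℂ V) y) := by
  rw [← Units.val_mul]
  refine Ad_eq ?_
  have h1 := toEnd_Ad hk hy
  have h2 := toEnd_Ad hg (mem_borel_of_sub_mem hy (Ad_sub_mem ⟨k, hk, rfl⟩ hy))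
  rw [Units.val_mul, ← mul_assoc, h2, mul_assoc, mul_assoc, h1]

theorem cartanProj_Ad {g : Module.End ℂ V} (hg : g ∈ unipotentPoints b V) {y : L}
    (hy : y ∈ borel b) : e.cartanProj (Ad g y) = e.cartanProj y := by
  have := cartanProj_of_mem_nilradical e (Ad_sub_mem hg hy)
  rwa [map_sub, sub_eq_zero] at this

/-- The height element `h₀` commutes with `x`, so its conjugate by `g` commutes with the conjugate
of `x`, which is `x` itself. Regularity of `x` then forces that conjugate to be `h₀`. -/
theorem eq_one_of_Ad_eq_self {g : (Module.End ℂ V)ˣ} (hg : g ∈ unipotent b V) {x : L}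
    (hx : x ∈ cartanReg b e) (h : Ad (g : Module.End ℂ V) x = x) : g = 1 := by
  obtain ⟨h₀, hh₀⟩ := exists_height_element b
  have h1 := toEnd_Ad hg (cartan_le_borel (b := b) hx.1)
  rw [h] at h1
  -- Here `z` is `Ad g h₀`, an element of `h₀ + 𝔫`.
  obtain ⟨z, hz, h2⟩ := exists_conj_of_mem_unipotent hg h₀ (cartan_le_borel h₀.2)
  have hxh : ⁅x, (h₀ : L)⁆ = 0 := by
    have : ⁅(⟨x, hx.1⟩ : H), h₀⁆ = 0 := trivial_lie_zero _ _ _ _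
    exact congrArg Subtype.val this
  have h3 := toEnd_lie (V := V) x (h₀ : L)
  have hxz : ⁅x, z⁆ = 0 := by
    rw [← toEnd_inj (V := V), toEnd_lie]
    have h4 : (toEnd ℂ L V x * toEnd ℂ L V z - toEnd ℂ L V z * toEnd ℂ L V x) * (g : Module.End ℂ V)
        = g * toEnd ℂ L V ⁅x, (h₀ : L)⁆ := by
      rw [h3, sub_mul, mul_sub, mul_assoc, mul_assoc, ← h2, h1, ← mul_assoc, h1, ← mul_assoc, ← h2]
      simp only [mul_assoc]
    rw [hxh] at h4
    have h5 : toEnd ℂ L V (0 : L) = 0 := map_zero (rep L V)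
    rw [h5, mul_zero] at h4
    rw [h5]
    exact (Units.mul_left_eq_zero g).mp h4
  have hzH := mem_cartan_of_lie_eq_zero e hx
    (mem_borel_of_sub_mem (cartan_le_borel h₀.2) hz) hxz
  -- Now `z = h₀`, so `g` commutes with `h₀`, while `g - 1` has only positive degrees.
  rw [eq_of_sub_mem_nilradical hzH h₀.2 hz e] at h2
  have h6 := eq_zero_of_mem_raising_of_commute (sub_one_mem_raising hh₀ hg) (by
    rw [mul_sub, sub_mul, ← h2]; simp)
  exact Units.ext (sub_eq_zero.mp h6)

theorem Ad_injective {g k : (Module.End ℂ V)ˣ} (hg : g ∈ unipotent b V) (hk : k ∈ unipotent b V)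
    {x z : L} (hx : x ∈ cartanReg b e) (hz : z ∈ cartanReg b e)
    (h : Ad (g : Module.End ℂ V) x = Ad (k : Module.End ℂ V) z) : g = k ∧ x = z := by
  have hxz : x = z := by
    have := congrArg e.cartanProj h
    rwa [cartanProj_Ad e ⟨g, hg, rfl⟩ (cartan_le_borel hx.1),
      cartanProj_Ad e ⟨k, hk, rfl⟩ (cartan_le_borel hz.1), e.cartanProj_of_mem hx.1,
      e.cartanProj_of_mem hz.1] at this
  subst hxz
  refine ⟨?_, rfl⟩
  have hki := inv_mem hk
  have h1 : Ad ((k⁻¹ * g : (Module.End ℂ V)ˣ) : Module.End ℂ V) x = x := by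
    rw [Units.val_mul, Ad_mul hki hg (cartan_le_borel hx.1), h,
      ← Ad_mul hki hk (cartan_le_borel hx.1), Units.inv_mul]
    exact Ad_eq (g := 1) (by simp)
  have := eq_one_of_Ad_eq_self e (mul_mem hki hg) hx h1
  exact (inv_mul_eq_one.mp this).symm

end LieAlg

/-! ### Maps with coordinates in an algebra of functions -/

section RegMap

variable {S W W' W'' : Type*} [AddCommGroup W] [Module ℂ W] [AddCommGroup W'] [Module ℂ W']
  [AddCommGroup W''] [Module ℂ W'']

/-- The coordinates of `φ` belong to the function algebra `A`. -/
def IsRegMap (A : Subalgebra ℂ (S → ℂ)) (φ : S → W) : Prop :=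
  ∀ l : Dual ℂ W, (fun s => l (φ s)) ∈ A

namespace IsRegMap

variable {A : Subalgebra ℂ (S → ℂ)}

theorem const (w : W) : IsRegMap A fun _ => w := fun l => A.algebraMap_mem (l w)

theorem add {φ ψ : S → W} (hφ : IsRegMap A φ) (hψ : IsRegMap A ψ) :
    IsRegMap A fun s => φ s + ψ s := fun l => by
  simp only [map_add]
  exact A.add_mem (hφ l) (hψ l)

theorem neg {φ : S → W} (hφ : IsRegMap A φ) : IsRegMap A fun s => -φ s := fun l => by
  simp only [map_neg]
  exact A.neg_mem (hφ l)

theorem sum {ι : Type*} (t : Finset ι) {φ : ι → S → W} (hφ : ∀ i ∈ t, IsRegMap A (φ i)) :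
    IsRegMap A fun s => ∑ i ∈ t, φ i s := fun l => by
  have : (fun s => l (∑ i ∈ t, φ i s)) = ∑ i ∈ t, fun s => l (φ i s) := by
    ext s; simp
  rw [this]
  exact A.sum_mem fun i hi => hφ i hi l

theorem smul {f : S → ℂ} {φ : S → W} (hf : f ∈ A) (hφ : IsRegMap A φ) :
    IsRegMap A fun s => f s • φ s := fun l => by
  simp only [map_smul, smul_eq_mul]
  exact A.mul_mem hf (hφ l)

theorem comp {φ : S → W} (T : W →ₗ[ℂ] W') (hφ : IsRegMap A φ) : IsRegMap A fun s => T (φ s) :=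
  fun l => hφ (l ∘ₗ T)

theorem bilin [FiniteDimensional ℂ W] {φ : S → W} {ψ : S → W'} (B : W →ₗ[ℂ] W' →ₗ[ℂ] W'')
    (hφ : IsRegMap A φ) (hψ : IsRegMap A ψ) : IsRegMap A fun s => B (φ s) (ψ s) := by
  have : (fun s => B (φ s) (ψ s)) =
      fun s => ∑ i, (finBasis ℂ W).coord i (φ s) • B (finBasis ℂ W i) (ψ s) := by
    ext s
    conv_lhs => rw [← (finBasis ℂ W).sum_repr (φ s)]
    simp only [map_sum, map_smul, LinearMap.sum_apply, LinearMap.smul_apply, Basis.coord_apply]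
  rw [this]
  exact IsRegMap.sum _ fun i _ => IsRegMap.smul (hφ _) (hψ.comp _)

theorem mul {R : Type*} [Ring R] [Algebra ℂ R] [FiniteDimensional ℂ R] {φ ψ : S → R}
    (hφ : IsRegMap A φ) (hψ : IsRegMap A ψ) : IsRegMap A fun s => φ s * ψ s :=
  hφ.bilin (LinearMap.mul ℂ R) hψ

theorem pow {R : Type*} [Ring R] [Algebra ℂ R] [FiniteDimensional ℂ R] {φ : S → R}
    (hφ : IsRegMap A φ) (k : ℕ) : IsRegMap A fun s => φ s ^ k := by
  induction k with
  | zero => simpa using IsRegMap.const (1 : R)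
  | succ k ih => simpa only [pow_succ] using ih.mul hφ

theorem prodMk {φ : S → W} {ψ : S → W'} (hφ : IsRegMap A φ) (hψ : IsRegMap A ψ) :
    IsRegMap A fun s => (φ s, ψ s) := fun l => by
  have : (fun s => l (φ s, ψ s)) = (fun s => (l ∘ₗ LinearMap.inl ℂ W W') (φ s)) +
      fun s => (l ∘ₗ LinearMap.inr ℂ W W') (ψ s) := by
    ext s; simp [← map_add]
  rw [this]
  exact A.add_mem (hφ _) (hψ _)

theorem polyFun (T : W →ₗ[ℂ] W') : IsRegMap (polyFun W) fun w => T w :=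
  fun l => Algebra.subset_adjoin ⟨l ∘ₗ T, fun _ => rfl⟩

end IsRegMap

end RegMap

/-! ### Localised function algebras -/

section Localised

variable {E : Type*} [AddCommGroup E] [Module ℂ E] {Λ : Set (Dual ℂ E)} {W W' : Set E}

theorem linear_mem_localizedFun (l : Dual ℂ E) :
    (fun y : nonvanishing Λ W => l (y : E)) ∈ localizedFun Λ W :=
  Algebra.subset_adjoin (Or.inl ⟨l, fun _ => rfl⟩)

theorem inv_mem_localizedFun {l : Dual ℂ E} (hl : l ∈ Λ) :
    (fun y : nonvanishing Λ W => (l (y : E))⁻¹) ∈ localizedFun Λ W :=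
  Algebra.subset_adjoin (Or.inr ⟨l, hl, fun _ => rfl⟩)

theorem IsRegMap.localizedFun {F : Type*} [AddCommGroup F] [Module ℂ F] (T : E →ₗ[ℂ] F) :
    IsRegMap (localizedFun Λ W) fun y => T y :=
  fun l => linear_mem_localizedFun (l ∘ₗ T)

theorem localizedFun_induction {p : (nonvanishing Λ W → ℂ) → Prop}
    (linear : ∀ l : Dual ℂ E, p fun y => l (y : E))
    (inv : ∀ l ∈ Λ, p fun y => (l (y : E))⁻¹)
    (const : ∀ c : ℂ, p fun _ => c)
    (add : ∀ f ∈ localizedFun Λ W, ∀ g ∈ localizedFun Λ W, p f → p g → p (f + g))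
    (mul : ∀ f ∈ localizedFun Λ W, ∀ g ∈ localizedFun Λ W, p f → p g → p (f * g))
    {f : nonvanishing Λ W → ℂ} (hf : f ∈ localizedFun Λ W) : p f := by
  induction hf using Algebra.adjoin_induction with
  | mem f hf =>
    obtain ⟨l, hl⟩ | ⟨l, hl, hf⟩ := hf
    · rw [funext hl]; exact linear l
    · rw [funext hf]; exact inv l hl
  | algebraMap c => exact const c
  | add f g hf hg ihf ihg => exact add f hf g hg ihf ihg
  | mul f g hf hg ihf ihg => exact mul f hf g hg ihf ihg

/-- The functionals in `Λ` must be preserved so that the inverted functions pull back to inverted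
functions; the pullbacks of linear functions are regular by hypothesis. -/
theorem comp_mem_localizedFun {Φ : nonvanishing Λ W' → nonvanishing Λ W}
    (hΦ : IsRegMap (localizedFun Λ W') fun y => (Φ y : E))
    (hΛ : ∀ l ∈ Λ, ∀ y, l (Φ y : E) = l (y : E)) {f : nonvanishing Λ W → ℂ}
    (hf : f ∈ localizedFun Λ W) : (fun y => f (Φ y)) ∈ localizedFun Λ W' := by
  refine localizedFun_induction (p := fun f => (fun y => f (Φ y)) ∈ localizedFun Λ W')
    (fun l => hΦ l) (fun l hl => ?_) (fun c => (localizedFun Λ W').algebraMap_mem c)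
    (fun f _ g _ hf hg => add_mem hf hg) (fun f _ g _ hf hg => mul_mem hf hg) hf
  simpa only [hΛ l hl] using inv_mem_localizedFun hl

/-- Composition with a regular map which preserves the functionals in `Λ`. -/
def compHom (Φ : nonvanishing Λ W → nonvanishing Λ W)
    (hΦ : IsRegMap (localizedFun Λ W) fun y => (Φ y : E))
    (hΛ : ∀ l ∈ Λ, ∀ y, l (Φ y : E) = l (y : E)) : localizedFun Λ W →ₐ[ℂ] localizedFun Λ W where
  toFun f := ⟨fun y => (f : nonvanishing Λ W → ℂ) (Φ y), comp_mem_localizedFun hΦ hΛ f.2⟩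
  map_one' := rfl
  map_mul' _ _ := rfl
  map_zero' := rfl
  map_add' _ _ := rfl
  commutes' _ := rfl

theorem linear_mem_polyFun (l : Dual ℂ E) : (fun y => l y) ∈ polyFun E :=
  Algebra.subset_adjoin ⟨l, fun _ => rfl⟩

/-- The product of a finite set of functionals. -/
def functionalProd (hΛ : Λ.Finite) (y : E) : ℂ := ∏ l ∈ hΛ.toFinset, l y

theorem functionalProd_mem_polyFun (hΛ : Λ.Finite) : functionalProd hΛ ∈ polyFun E := by
  have : functionalProd hΛ = ∏ l ∈ hΛ.toFinset, fun y => l y := by ext y; simp [functionalProd]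
  rw [this]
  exact prod_mem fun l _ => linear_mem_polyFun l

theorem functionalProd_ne_zero_iff (hΛ : Λ.Finite) (y : E) :
    functionalProd hΛ y ≠ 0 ↔ ∀ l ∈ Λ, l y ≠ 0 := by
  simp [functionalProd, Finset.prod_ne_zero_iff]

/-- All denominators can be taken to be powers of the single product of the inverted functionals;
this turns membership in the algebra into regularity on a principal open set. -/
theorem exists_eq_div_of_mem_localizedFun (hΛ : Λ.Finite) {f : nonvanishing Λ W → ℂ}
    (hf : f ∈ localizedFun Λ W) : ∃ p ∈ polyFun E, ∃ k : ℕ, ∀ y : nonvanishing Λ W,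
      f y = p y / functionalProd hΛ y ^ k := by
  classical
  have hne : ∀ y : nonvanishing Λ W, functionalProd hΛ (y : E) ≠ 0 := fun y =>
    (functionalProd_ne_zero_iff hΛ _).mpr y.2.2
  have hs := functionalProd_mem_polyFun hΛ
  refine localizedFun_induction (p := fun f => ∃ p ∈ polyFun E, ∃ k : ℕ,
    ∀ y : nonvanishing Λ W, f y = p y / functionalProd hΛ y ^ k) ?_ ?_ ?_ ?_ ?_ hf
  · intro l
    exact ⟨_, linear_mem_polyFun l, 0, fun y => by simp⟩
  · intro l hl
    refine ⟨∏ m ∈ hΛ.toFinset.erase l, fun y => m y, prod_mem fun m _ => linear_mem_polyFun m, 1,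
      fun y => ?_⟩
    have h1 : functionalProd hΛ (y : E) = l y * ∏ m ∈ hΛ.toFinset.erase l, m (y : E) :=
      (Finset.mul_prod_erase _ (fun m : Dual ℂ E => m (y : E)) (hΛ.mem_toFinset.mpr hl)).symm
    have h2 := hne y
    rw [h1] at h2
    rw [pow_one, h1, Finset.prod_apply]
    field_simp [left_ne_zero_of_mul h2, right_ne_zero_of_mul h2]
  · intro c
    exact ⟨_, (polyFun E).algebraMap_mem c, 0, fun y => by simp⟩
  · intro f _ g _ hf hg
    obtain ⟨p, hp, k, hf⟩ := hf
    obtain ⟨q, hq, l, hg⟩ := hg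
    refine ⟨p * functionalProd hΛ ^ l + q * functionalProd hΛ ^ k,
      add_mem (mul_mem hp (pow_mem hs l)) (mul_mem hq (pow_mem hs k)), k + l, fun y => ?_⟩
    have := hne y
    simp only [Pi.add_apply, Pi.mul_apply, Pi.pow_apply, hf, hg]
    field_simp
    ring
  · intro f _ g _ hf hg
    obtain ⟨p, hp, k, hf⟩ := hf
    obtain ⟨q, hq, l, hg⟩ := hg
    refine ⟨p * q, mul_mem hp hq, k + l, fun y => ?_⟩
    have := hne y
    simp only [Pi.mul_apply, hf, hg]
    field_simp
    ring

theorem extendZero_apply {E : Type*} {U : Set E} (f : U → ℂ) {y : E} (hy : y ∈ U) :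
    extendZero f y = f ⟨y, hy⟩ :=
  Subtype.val_injective.extend_apply f 0 ⟨y, hy⟩

end Localised

section Elimination

variable {L : Type*} [LieRing L] [LieAlgebra ℂ L] [FiniteDimensional ℂ L] [IsKilling ℂ L]
  {H : LieSubalgebra ℂ L} [H.IsCartanSubalgebra] (b : (rootSystem H).Base) (e : RootVectors H)

theorem finite_posFunctionals : (posFunctionals b e).Finite := by
  have : posFunctionals b e = Set.range fun α : PosRoot b => e.hHat α.1 := by
    ext l; simp only [posFunctionals, Set.mem_ofPred_eq, Set.mem_range, eq_comm]
  rw [this]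
  exact Set.finite_range _

/-! ### Elimination of coordinates -/

theorem isNilpotent_ad_vec (α : H.root) : IsNilpotent (ad ℂ L (e.vec α)) :=
  isNilpotent_toEnd_of_mem_rootSpace (M := L) H (LieSubalgebra.isNonZero_coe_root α) (e.vec_mem α)

variable {b} in
/-- The curve `exp (t e_α) y` in the open part of the Borel subalgebra. -/
def rootFlow (α : PosRoot b) (t : ℂ) (y : borelReg b e) : borelReg b e :=
  ⟨nilExp (ad ℂ L (t • e.vec α.1)) (y : L),
    mem_borelReg_of_sub_mem e y.2 (nilExp_ad_sub_mem (Submodule.smul_mem _ _ (vec_mem_nilradical b e α))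
      (by rw [map_smul]; exact (isNilpotent_ad_vec e α.1).smul t) y.2.1)⟩

variable {b}

theorem coe_rootFlow (α : PosRoot b) (t : ℂ) (y : borelReg b e) :
    (rootFlow e α t y : L) = nilExp (t • ad ℂ L (e.vec α.1)) (y : L) := by
  rw [← map_smul]; rfl

theorem rootFlow_add (α : PosRoot b) (s t : ℂ) (y : borelReg b e) :
    rootFlow e α (s + t) y = rootFlow e α s (rootFlow e α t y) := by
  apply Subtype.ext
  have hn := isNilpotent_ad_vec e α.1
  rw [coe_rootFlow, coe_rootFlow, coe_rootFlow, add_smul, nilExp_add_of_commute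
    (((Commute.refl _).smul_left s).smul_right t) (hn.smul s) (hn.smul t)]
  rfl

@[simp]
theorem rootFlow_zero (α : PosRoot b) (y : borelReg b e) : rootFlow e α 0 y = y := by
  apply Subtype.ext
  rw [coe_rootFlow]
  simp

theorem rootFlow_sub_mem (α : PosRoot b) (t : ℂ) (y : borelReg b e) :
    (rootFlow e α t y : L) - y ∈ borelNilradical b :=
  nilExp_ad_sub_mem (Submodule.smul_mem _ _ (vec_mem_nilradical b e α))
    (by rw [map_smul]; exact (isNilpotent_ad_vec e α.1).smul t) y.2.1

theorem hHat_rootFlow (α : PosRoot b) (t : ℂ) (y : borelReg b e) (γ : H.root) :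
    e.hHat γ (rootFlow e α t y : L) = e.hHat γ (y : L) := by
  have := hHat_of_mem_nilradical e (rootFlow_sub_mem e α t y) γ
  rwa [map_sub, sub_eq_zero] at this

theorem cartanProj_rootFlow (α : PosRoot b) (t : ℂ) (y : borelReg b e) :
    e.cartanProj (rootFlow e α t y : L) = e.cartanProj (y : L) := by
  have := cartanProj_of_mem_nilradical e (rootFlow_sub_mem e α t y)
  rwa [map_sub, sub_eq_zero] at this

/-- The map `y ↦ exp ((c_α / α(h)) e_α) y`, which eliminates the coordinate `c_α`. -/
def elim (α : PosRoot b) (y : borelReg b e) : borelReg b e :=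
  rootFlow e α (e.coeff α.1 y / e.hHat α.1 y) y

theorem coeff_div_hHat_mem (α : PosRoot b) :
    (fun y : borelReg b e => e.coeff α.1 y / e.hHat α.1 y) ∈ borelFun b e := by
  simp only [div_eq_mul_inv]
  exact mul_mem (S := Subalgebra ℂ _) (linear_mem_localizedFun (e.coeff α.1))
    (inv_mem_localizedFun (W := (borel b : Set L)) (⟨α, rfl⟩ : e.hHat α.1 ∈ posFunctionals b e))

theorem isRegMap_elim (α : PosRoot b) : IsRegMap (borelFun b e) fun y => (elim e α y : L) := by
  obtain ⟨k, hk⟩ := isNilpotent_ad_vec e α.1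
  have : (fun y => (elim e α y : L)) = fun y : borelReg b e => ∑ i ∈ Finset.range k,
      (e.coeff α.1 y / e.hHat α.1 y) ^ i • ((i.factorial : ℂ)⁻¹ • ad ℂ L (e.vec α.1) ^ i) (y : L) := by
    ext1 y
    rw [elim, coe_rootFlow, nilExp_smul_apply hk]
    rfl
  rw [this]
  exact IsRegMap.sum _ fun i _ => IsRegMap.smul (pow_mem (coeff_div_hHat_mem e α) i)
    (IsRegMap.localizedFun _)

/-- The operator `P_α`. -/
def elimHom (α : PosRoot b) : borelFun b e →ₐ[ℂ] borelFun b e :=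
  compHom (elim e α) (isRegMap_elim e α) (by
    rintro _ ⟨γ, rfl⟩ y
    exact hHat_rootFlow e α _ y γ.1)

/-- The projection of the open part of the Borel subalgebra to the Cartan subalgebra. -/
def regProj (y : borelReg b e) : borelReg b e :=
  ⟨e.cartanProj (y : L), cartanReg_subset_borelReg e (cartanProj_mem_cartanReg e y.2)⟩

variable (b) in
/-- The operator `P`. -/
def projHom : borelFun b e →ₐ[ℂ] borelFun b e :=
  compHom (regProj e) (IsRegMap.localizedFun e.cartanProj) (by
    rintro _ ⟨γ, rfl⟩ y
    exact e.hHat_cartanProj γ.1 y)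

/-- Successive elimination of the coordinates in a list of positive roots. -/
def elimList (ls : List (PosRoot b)) (y : borelReg b e) : borelReg b e :=
  ls.foldl (fun z α => elim e α z) y

theorem elimList_cons (α : PosRoot b) (ls : List (PosRoot b)) (y : borelReg b e) :
    elimList e (α :: ls) y = elimList e ls (elim e α y) := rfl

/-- Pullback reverses composition: the leftmost operator of the product is the first elimination
applied to the point. -/
theorem prod_elimHom_apply (ls : List (PosRoot b)) (f : borelFun b e) (y : borelReg b e) :
    ((ls.map fun α => (elimHom e α).toLinearMap).prod f : borelReg b e → ℂ) y =
      (f : borelReg b e → ℂ) (elimList e ls y) := by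
  induction ls generalizing y with
  | nil => rfl
  | cons α ls ih =>
    rw [List.map_cons, List.prod_cons, elimList_cons, ← ih]
    rfl

/-- Lists of positive roots such that after each member `β` the remaining ones are stable under
addition of `β`. -/
def IsEliminationOrder (ls : List (PosRoot b)) : Prop :=
  ∀ pre β post, ls = pre ++ β :: post → ∀ γ ∈ post, ∀ δ : PosRoot b,
    (rootSystem H).root δ.1 = (rootSystem H).root β.1 + (rootSystem H).root γ.1 → δ ∈ post

/-- A nonzero bracket lies in a nonzero weight space; its weight takes a positive value on the
height element, so it is not zero and is a positive root. -/
theorem lie_vec_vec {β γ : PosRoot b} (h : ⁅e.vec β.1, e.vec γ.1⁆ ≠ 0) :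
    ∃ (δ : PosRoot b) (c : ℂ),
      (rootSystem H).root δ.1 = (rootSystem H).root β.1 + (rootSystem H).root γ.1 ∧
      ⁅e.vec β.1, e.vec γ.1⁆ = c • e.vec δ.1 := by
  have hxy : ⁅e.vec β.1, e.vec γ.1⁆ ∈
      rootSpace H ((β.1 : Weight ℂ H L) + (γ.1 : Weight ℂ H L) : H → ℂ) :=
    lie_mem_genWeightSpace_of_mem_genWeightSpace (e.vec_mem _) (e.vec_mem _)
  have hne : rootSpace H ((β.1 : Weight ℂ H L) + (γ.1 : Weight ℂ H L) : H → ℂ) ≠ ⊥ := by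
    intro hbot
    rw [hbot] at hxy
    exact h (by simpa using hxy)
  let δ : Weight ℂ H L := ⟨_, hne⟩
  obtain ⟨h₀, hh₀⟩ := exists_height_element b
  have hδ₀ : δ h₀ = ((b.height β.1 + b.height γ.1 : ℤ) : ℂ) := by
    push_cast
    rw [← hh₀, ← hh₀]; rfl
  have hpos : 0 < b.height β.1 + b.height γ.1 := add_pos β.2 γ.2
  have hδ : δ.IsNonZero := by
    intro hz
    have : δ h₀ = 0 := by rw [hz]; rfl
    rw [hδ₀] at this
    exact hpos.ne' (by exact_mod_cast this)
  have hδ' : δ ∈ H.root := by simpa using hδ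
  have hroot : (rootSystem H).root ⟨δ, hδ'⟩ =
      (rootSystem H).root β.1 + (rootSystem H).root γ.1 := by
    ext z; simp [δ]
  obtain ⟨c, hc⟩ := e.exists_smul_vec (α := ⟨δ, hδ'⟩) hxy
  exact ⟨⟨⟨δ, hδ'⟩, RootPairing.Base.IsPos.add β.2 γ.2 hroot⟩, c, hroot, hc⟩

/-- The span `W` of the root vectors in `S` is stable under `ad e_β`, hence under `exp (t e_β)`.
This exponential fixes `e_β` and sends `h` to `h - t β(h) e_β`; the choice of `t` makes `t β(h)`
equal to the coordinate of `y` at `β`, so only terms in `W` survive. -/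
theorem elim_sub_cartanProj_mem {β : PosRoot b} {S : Set (PosRoot b)}
    (hS : ∀ γ ∈ S, ∀ δ : PosRoot b,
      (rootSystem H).root δ.1 = (rootSystem H).root β.1 + (rootSystem H).root γ.1 → δ ∈ S)
    {y : borelReg b e}
    (hy : (y : L) - e.cartanProj (y : L) ∈
      Submodule.span ℂ ((fun γ : PosRoot b => e.vec γ.1) '' (insert β S))) :
    (elim e β y : L) - e.cartanProj (y : L) ∈
      Submodule.span ℂ ((fun γ : PosRoot b => e.vec γ.1) '' S) := by
  set W := Submodule.span ℂ ((fun γ : PosRoot b => e.vec γ.1) '' S) with hW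
  have hstab : ∀ w ∈ W, ad ℂ L (e.vec β.1) w ∈ W := by
    intro w hw
    induction hw using Submodule.span_induction with
    | mem w hw =>
      obtain ⟨γ, hγ, rfl⟩ := hw
      by_cases h0 : ⁅e.vec β.1, e.vec γ.1⁆ = 0
      · simp [h0]
      · obtain ⟨δ, c, hδ, hc⟩ := lie_vec_vec e h0
        rw [ad_apply, hc]
        exact Submodule.smul_mem _ _ (Submodule.subset_span ⟨δ, hS γ hγ δ hδ, rfl⟩)
    | zero => simp
    | add x y _ _ hx hy => rw [map_add]; exact add_mem hx hy
    | smul c x _ hx => rw [map_smul]; exact Submodule.smul_mem _ _ hx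
  have hpow : ∀ w ∈ W, ∀ i, (ad ℂ L (e.vec β.1) ^ i) w ∈ W := by
    intro w hw i
    induction i with
    | zero => simpa using hw
    | succ i ih => rw [pow_succ', Module.End.mul_apply]; exact hstab _ ih
  obtain ⟨k, hk⟩ := isNilpotent_ad_vec e β.1
  -- The surplus `2` guarantees that the terms of order `0` and `1` can be split off the sum.
  have hk2 : ad ℂ L (e.vec β.1) ^ (k + 2) = 0 := pow_eq_zero_of_le (by omega) hk
  set t := e.coeff β.1 (y : L) / e.hHat β.1 (y : L) with ht
  have hne : e.hHat β.1 (y : L) ≠ 0 := y.2.2 _ ⟨β, rfl⟩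
  rw [Set.image_insert_eq, Submodule.mem_span_insert] at hy
  obtain ⟨c, w, hw, hyw⟩ := hy
  set h := e.cartanProj (y : L) with hh
  have hhH : h ∈ H := e.cartanProj_mem _
  have hexpw : nilExp (t • ad ℂ L (e.vec β.1)) w ∈ W := by
    rw [nilExp_smul_apply hk]
    exact Submodule.sum_mem _ fun i _ => Submodule.smul_mem _ _ (Submodule.smul_mem _ _ (hpow w hw i))
  have hexpe : nilExp (t • ad ℂ L (e.vec β.1)) (e.vec β.1) = e.vec β.1 := by
    rw [nilExp_smul_apply hk2, Finset.sum_range_succ', Finset.sum_eq_zero]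
    · simp
    · intro i _
      have : (ad ℂ L (e.vec β.1) ^ (i + 1)) (e.vec β.1) = 0 := by
        rw [pow_succ, Module.End.mul_apply, ad_apply, lie_self, map_zero]
      rw [this, smul_zero, smul_zero]
  have hlieh : ⁅e.vec β.1, h⁆ = -(e.hHat β.1 (y : L) • e.vec β.1) := by
    rw [← lie_skew, e.lie_cartan_vec hhH, hh, e.hHat_cartanProj]
  have hexph : nilExp (t • ad ℂ L (e.vec β.1)) h =
      h - (t * e.hHat β.1 (y : L)) • e.vec β.1 := by
    rw [nilExp_smul_apply hk2, Finset.sum_range_succ', Finset.sum_range_succ', Finset.sum_eq_zero]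
    · simp [hlieh, mul_smul, sub_eq_add_neg, add_comm]
    · intro i _
      have : (ad ℂ L (e.vec β.1) ^ (i + 1 + 1)) h = 0 := by
        rw [pow_succ, pow_succ, Module.End.mul_apply, Module.End.mul_apply, ad_apply,
          ad_apply, hlieh, lie_neg, lie_smul, lie_self, smul_zero, neg_zero, map_zero]
      rw [this, smul_zero, smul_zero]
  have hyd : (y : L) = h + (c • e.vec β.1 + w) := by rw [← hyw]; abel
  -- The case `β ∈ S` is not excluded; then this vector is in `W` anyway. Otherwise `w` has no
  -- component at `β`, and the coefficient is zero.
  have hcw : (c - e.coeff β.1 (y : L)) • e.vec β.1 ∈ W := by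
    by_cases hβ : β ∈ S
    · exact Submodule.smul_mem _ _ (Submodule.subset_span ⟨β, hβ, rfl⟩)
    · have hw0 : e.coeff β.1 w = 0 := by
        clear hyw hexpw hyd
        induction hw using Submodule.span_induction with
        | mem w hw =>
          obtain ⟨γ, hγ, rfl⟩ := hw
          refine e.coeff_vec_of_ne fun h => hβ ?_
          rwa [Subtype.ext h]
        | zero => simp
        | add x y _ _ hx hy => rw [map_add, hx, hy, add_zero]
        | smul c x _ hx => rw [map_smul, hx, smul_zero]
      have : e.coeff β.1 (y : L) = c := by
        rw [hyd, map_add, map_add, map_smul, e.coeff_of_mem hhH, e.coeff_vec_self, hw0]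
        simp
      rw [this, sub_self, zero_smul]
      exact zero_mem _
  have key : (elim e β y : L) - h =
      (c - e.coeff β.1 (y : L)) • e.vec β.1 + nilExp (t • ad ℂ L (e.vec β.1)) w := by
    rw [elim, coe_rootFlow, ← ht]
    conv_lhs => rw [hyd]
    rw [map_add, map_add, map_smul, hexph, hexpe, ht, div_mul_cancel₀ _ hne, sub_smul]
    abel
  rw [key]
  exact add_mem hcw hexpw

end Elimination

section Elimination

variable {L : Type*} [LieRing L] [LieAlgebra ℂ L] [FiniteDimensional ℂ L] [IsKilling ℂ L]
  {H : LieSubalgebra ℂ L} [H.IsCartanSubalgebra] {b : (rootSystem H).Base} (e : RootVectors H)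

theorem IsEliminationOrder.tail {β : PosRoot b} {ls : List (PosRoot b)}
    (h : IsEliminationOrder (β :: ls)) : IsEliminationOrder ls := by
  intro pre γ post hls
  exact h (β :: pre) γ post (by rw [hls]; rfl)

theorem elimList_eq_regProj_of_mem_span {ls : List (PosRoot b)} (h : IsEliminationOrder ls)
    (y : borelReg b e)
    (hy : (y : L) - e.cartanProj (y : L) ∈
      Submodule.span ℂ ((fun γ : PosRoot b => e.vec γ.1) '' {γ | γ ∈ ls})) :
    elimList e ls y = regProj e y := by
  induction ls generalizing y with
  | nil =>
    have hy0 : (y : L) = e.cartanProj (y : L) := by simpa [sub_eq_zero] using hy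
    exact Subtype.ext hy0
  | cons β ls ih =>
    have hset : {γ | γ ∈ β :: ls} = insert β {γ | γ ∈ ls} := by
      ext γ; simp
    rw [hset] at hy
    have hproj : e.cartanProj (elim e β y : L) = e.cartanProj (y : L) :=
      cartanProj_rootFlow e β _ y
    rw [elimList_cons, ih h.tail]
    · exact Subtype.ext hproj
    · rw [hproj]
      exact elim_sub_cartanProj_mem e (fun γ hγ δ hδ => h [] β ls rfl γ hγ δ hδ) hy

theorem elimList_eq_regProj {ls : List (PosRoot b)} (h : IsEliminationOrder ls)
    (hls : ∀ γ, γ ∈ ls) (y : borelReg b e) : elimList e ls y = regProj e y := by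
  refine elimList_eq_regProj_of_mem_span e h y ?_
  have h1 := sub_cartanProj_mem e y.2.1
  have h2 : {γ | γ ∈ ls} = Set.univ := Set.eq_univ_of_forall hls
  rwa [nilradical_eq_span e, ← Set.image_univ, ← h2] at h1

/-- As the list contains all positive roots, `δ = β + γ` occurs somewhere: it cannot precede `β` by
the assumption on `r`, nor equal `β` since `γ ≠ 0`. -/
theorem isEliminationOrder_of_pairwise {r : PosRoot b → PosRoot b → Prop} {ls : List (PosRoot b)}
    (hr : ∀ β γ δ : PosRoot b, r β γ →
      (rootSystem H).root δ.1 = (rootSystem H).root β.1 + (rootSystem H).root γ.1 → ¬ r δ β)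
    (hp : ls.Pairwise r) (hls : ∀ γ, γ ∈ ls) : IsEliminationOrder ls := by
  rintro pre β post rfl γ hγ δ hδ
  rw [List.pairwise_append, List.pairwise_cons] at hp
  have hne : δ ≠ β := by
    rintro rfl
    exact (rootSystem H).ne_zero γ.1 (left_eq_add.mp hδ)
  have hmem := hls δ
  rw [List.mem_append, List.mem_cons] at hmem
  rcases hmem with h | h | h
  · exact absurd (hp.2.2 δ h β (List.mem_cons_self ..)) (hr β γ δ (hp.2.1.1 γ hγ) hδ)
  · exact absurd h hne
  · exact h

variable (b) in
-- Sort by increasing height: a sum of positive roots is higher than either summand. This gives the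
-- section of the action map without assuming that a normal ordering exists.
theorem exists_isEliminationOrder :
    ∃ ls : List (PosRoot b), IsEliminationOrder ls ∧ ∀ γ, γ ∈ ls := by
  have := Fintype.ofFinite (PosRoot b)
  let r : PosRoot b → PosRoot b → Prop := fun α β => b.height α.1 ≤ b.height β.1
  classical
  have hmem : ∀ γ, γ ∈ (Finset.univ : Finset (PosRoot b)).toList.insertionSort r := by
    intro γ
    rw [List.mem_insertionSort]
    simp
  have : Std.Total r := ⟨fun α β => le_total (b.height α.1) (b.height β.1)⟩
  have : IsTrans _ r := ⟨fun α β γ h₁ h₂ => le_trans (a := b.height α.1) h₁ h₂⟩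
  refine ⟨_, isEliminationOrder_of_pairwise (r := r) ?_ (List.pairwise_insertionSort r _) hmem, hmem⟩
  intro β γ δ _ hδ h
  have h1 := b.height_add hδ
  have h2 : 0 < b.height γ.1 := γ.2
  have h3 : b.height δ.1 ≤ b.height β.1 := h
  omega

/-- In the reversed list `β` precedes `γ` when its index is larger; the sum, if a root, has an index
in between and so comes after `β`. -/
theorem IsNormalOrdering.isEliminationOrder {m : ℕ} {β : Fin m ≃ PosRoot b}
    (h : IsNormalOrdering b β) : IsEliminationOrder (List.ofFn β).reverse := by
  refine isEliminationOrder_of_pairwise (r := fun x y => β.symm y < β.symm x) ?_ ?_ ?_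
  · intro x y z hxy hz hzx
    have := h (β.symm x) (β.symm y) (β.symm z) (by simpa using hz)
    rcases this with h | h
    · exact absurd (h.1.trans h.2) hxy.not_gt
    · exact absurd hzx h.2.not_gt
  · rw [List.pairwise_reverse, List.pairwise_ofFn]
    intro i j hij
    simpa using hij
  · intro γ
    rw [List.mem_reverse, List.mem_ofFn]
    exact ⟨β.symm γ, by simp⟩

theorem prod_elimHom_eq_projHom {ls : List (PosRoot b)} (h : IsEliminationOrder ls)
    (hls : ∀ γ, γ ∈ ls) :
    (ls.map fun α => (elimHom e α).toLinearMap).prod = (projHom b e).toLinearMap := by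
  ext f y
  rw [prod_elimHom_apply, elimList_eq_regProj e h hls]
  rfl

/-! ### Realisation of the elimination by elements of the unipotent group -/

variable (V : Type*) [AddCommGroup V] [Module ℂ V] [LieRingModule L V] [LieModule ℂ L V]
  [FiniteDimensional ℂ V]

/-- `G y` is the product of the inverses `exp (-t e_α)` of the elimination steps, so it undoes the
elimination. -/
theorem exists_unipotent_elimList [LieModule.IsFaithful ℂ L V] (ls : List (PosRoot b)) :
    ∃ G : borelReg b e → (Module.End ℂ V)ˣ, (∀ y, G y ∈ unipotent b V) ∧
      IsRegMap (borelFun b e) (fun y => (G y : Module.End ℂ V)) ∧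
      ∀ y, Ad (G y : Module.End ℂ V) (elimList e ls y : L) = y := by
  induction ls with
  | nil =>
    refine ⟨fun _ => 1, fun y => one_mem _, IsRegMap.const _, fun y => ?_⟩
    exact Ad_eq (by simp [elimList])
  | cons α ls ih =>
    obtain ⟨G, hG, hreg, hAd⟩ := ih
    set t : borelReg b e → ℂ := fun y => e.coeff α.1 y / e.hHat α.1 y with ht
    have hz : ∀ y, -t y • e.vec α.1 ∈ borelNilradical b := fun y =>
      Submodule.smul_mem _ _ (vec_mem_nilradical b e α)
    have hX : ∀ y, toEnd ℂ L V (-t y • e.vec α.1) = -t y • toEnd ℂ L V (e.vec α.1) := fun y =>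
      map_smul (rep L V) _ _
    let g : borelReg b e → (Module.End ℂ V)ˣ := fun y =>
      nilExpUnit _ (isNilpotent_toEnd_of_mem_nilradical (V := V) (hz y))
    have hg : ∀ y, g y ∈ unipotent b V := fun y => Subgroup.subset_closure ⟨_, hz y, rfl⟩
    refine ⟨fun y => g y * G (elim e α y), fun y => mul_mem (hg y) (hG _), ?_, fun y => ?_⟩
    · simp only [Units.val_mul]
      refine IsRegMap.mul ?_ ?_
      · obtain ⟨k, hk⟩ := isNilpotent_toEnd_of_mem_nilradical (V := V) (vec_mem_nilradical b e α)
        have : (fun y => (g y : Module.End ℂ V)) = fun y => ∑ i ∈ Finset.range k,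
            (-t y) ^ i • ((i.factorial : ℂ)⁻¹ • toEnd ℂ L V (e.vec α.1) ^ i) := by
          ext1 y
          change nilExp (toEnd ℂ L V (-t y • e.vec α.1)) = _
          rw [hX, nilExp_eq_sum (k := k) (by rw [smul_pow, hk, smul_zero])]
          refine Finset.sum_congr rfl fun i _ => ?_
          rw [smul_pow, smul_comm]
        rw [this]
        refine IsRegMap.sum _ fun i _ => IsRegMap.smul (pow_mem ?_ i) (IsRegMap.const _)
        exact neg_mem (coeff_div_hHat_mem e α)
      -- The later factors are evaluated at the point after the first step; pullback along that step
      -- preserves the algebra.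
      · exact fun l => (elimHom e α ⟨_, hreg l⟩).2
    · rw [Units.val_mul, elimList_cons, Ad_mul (hg y) (hG _) (elimList e ls (elim e α y)).2.1, hAd]
      change Ad (nilExp (toEnd ℂ L V (-t y • e.vec α.1))) _ = _
      rw [Ad_nilExp (isNilpotent_toEnd_of_mem_nilradical (V := V) (hz y))]
      change (rootFlow e α (-t y) (rootFlow e α (t y) y) : L) = y
      rw [← rootFlow_add, neg_add_cancel, rootFlow_zero]

variable (b) in
theorem exists_unipotent_section [LieModule.IsFaithful ℂ L V] :
    ∃ G : borelReg b e → (Module.End ℂ V)ˣ, (∀ y, G y ∈ unipotent b V) ∧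
      IsRegMap (borelFun b e) (fun y => (G y : Module.End ℂ V)) ∧
      ∀ y : borelReg b e, Ad (G y : Module.End ℂ V) (e.cartanProj (y : L)) = y := by
  obtain ⟨ls, h, hls⟩ := exists_isEliminationOrder b
  obtain ⟨G, hG, hreg, hAd⟩ := exists_unipotent_elimList e V ls
  refine ⟨G, hG, hreg, fun y => ?_⟩
  have := hAd y
  rwa [elimList_eq_regProj e h hls] at this

theorem Ad_rootElement [LieModule.IsFaithful ℂ L V] (α : PosRoot b) (y : borelReg b e) :
    Ad (rootElement b V e α (y : L)) (y : L) = elim e α y := by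
  have hz : (e.coeff α.1 (y : L) / e.hHat α.1 (y : L)) • e.vec α.1 ∈ borelNilradical b :=
    Submodule.smul_mem _ _ (vec_mem_nilradical b e α)
  have hX : toEnd ℂ L V ((e.coeff α.1 (y : L) / e.hHat α.1 (y : L)) • e.vec α.1) = _ :=
    map_smul (rep L V) _ _
  rw [rep_apply] at hX
  rw [rootElement, ← hX, Ad_nilExp (isNilpotent_toEnd_of_mem_nilradical (V := V) hz)]
  rfl

/-! ### The action map -/

variable (b) in
-- Since `1 - g` is nilpotent with an exponent uniform in `g ∈ N`, the geometric series stops and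
-- inversion on `N` is polynomial.
theorem exists_inverse_polynomial : ∃ k, ∀ g : (Module.End ℂ V)ˣ, g ∈ unipotent b V →
    ((g⁻¹ : (Module.End ℂ V)ˣ) : Module.End ℂ V) =
      ∑ i ∈ Finset.range k, (1 - (g : Module.End ℂ V)) ^ i := by
  obtain ⟨h, hh⟩ := exists_height_element b
  obtain ⟨k, hk⟩ := exists_pow_eq_zero_of_raising (toEnd ℂ L V (h : L))
  refine ⟨k + 1, fun g hg => ?_⟩
  rw [Units.inv_eq_of_mul_eq_one_right]
  have h1 := mul_neg_geom_sum (1 - (g : Module.End ℂ V)) (k + 1)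
  have h2 : (1 - (g : Module.End ℂ V)) ^ (k + 1) = 0 := by
    refine hk _ ?_
    rw [← neg_sub]
    exact neg_mem (sub_one_mem_raising hh hg)
  rwa [h2, sub_sub_cancel, sub_zero] at h1

variable [LieModule.IsFaithful ℂ L V]

variable (b) in
theorem bijOn_Ad : Set.BijOn (fun p : Module.End ℂ V × L => Ad p.1 p.2)
    (unipotentPoints b V ×ˢ cartanReg b e) (borelReg b e) := by
  refine ⟨?_, ?_, ?_⟩
  · rintro ⟨g, x⟩ ⟨hg, hx⟩
    have hx' := cartanReg_subset_borelReg e hx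
    exact mem_borelReg_of_sub_mem e hx' (Ad_sub_mem hg hx'.1)
  · rintro ⟨_, x⟩ ⟨⟨g, hg, rfl⟩, hx⟩ ⟨_, z⟩ ⟨⟨k, hk, rfl⟩, hz⟩ h
    obtain ⟨rfl, rfl⟩ := Ad_injective e hg hk hx hz h
    rfl
  · intro y hy
    obtain ⟨G, hG, -, hAd⟩ := exists_unipotent_section b e V
    exact ⟨((G ⟨y, hy⟩ : Module.End ℂ V), e.cartanProj y),
      ⟨⟨_, hG _, rfl⟩, cartanProj_mem_cartanReg e hy⟩, hAd ⟨y, hy⟩⟩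

theorem polyFun_comp_linear {E F : Type*} [AddCommGroup E] [Module ℂ E] [AddCommGroup F]
    [Module ℂ F] (T : E →ₗ[ℂ] F) {p : F → ℂ} (hp : p ∈ polyFun F) :
    (fun v => p (T v)) ∈ polyFun E := by
  induction hp using Algebra.adjoin_induction with
  | mem p hp =>
    obtain ⟨l, hl⟩ := hp
    simp only [hl]
    exact linear_mem_polyFun (l ∘ₗ T)
  | algebraMap c => exact (polyFun E).algebraMap_mem c
  | add p q _ _ hp hq => exact add_mem hp hq
  | mul p q _ _ hp hq => exact mul_mem hp hq

variable (b) in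
open Classical in
theorem isBirational_Ad (e : RootVectors H) :
    IsBirational (unipotentPoints b V ×ˢ (H : Set L)) (borel b : Set L)
      (fun p : Module.End ℂ V × L => Ad p.1 p.2) := by
  obtain ⟨G, hG, hreg, hAd⟩ := exists_unipotent_section b e V
  have hΛ := finite_posFunctionals b e
  obtain ⟨x₀, hx₀⟩ := exists_mem_cartanReg b e
  have hbij := bijOn_Ad b e V
  -- The value off `𝔟'` is arbitrary: birationality tests the inverse only where the product of the
  -- positive roots is nonzero.
  let ψ : L → Module.End ℂ V × L := fun y =>
    if h : y ∈ borelReg b e then ((G ⟨y, h⟩ : Module.End ℂ V), e.cartanProj y) else 0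
  have hψ : ∀ y (h : y ∈ borelReg b e), ψ y = ((G ⟨y, h⟩ : Module.End ℂ V), e.cartanProj y) :=
    fun y h => dif_pos h
  have hψmem : ∀ y ∈ borelReg b e, ψ y ∈ unipotentPoints b V ×ˢ cartanReg b e := by
    intro y hy
    rw [hψ y hy]
    exact ⟨⟨_, hG _, rfl⟩, cartanProj_mem_cartanReg e hy⟩
  have hψAd : ∀ y ∈ borelReg b e, Ad (ψ y).1 (ψ y).2 = y := by
    intro y hy
    rw [hψ y hy]
    exact hAd ⟨y, hy⟩
  refine ⟨fun p => functionalProd hΛ p.2,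
    polyFun_comp_linear (LinearMap.snd ℂ (Module.End ℂ V) L) (functionalProd_mem_polyFun hΛ),
    functionalProd hΛ, functionalProd_mem_polyFun hΛ, ψ, ?_, ?_, ?_, ?_, ?_, ?_⟩
  · exact ⟨(1, x₀), ⟨⟨1, one_mem _, rfl⟩, hx₀.1⟩, (functionalProd_ne_zero_iff hΛ _).mpr hx₀.2⟩
  · exact ⟨x₀, cartan_le_borel hx₀.1, (functionalProd_ne_zero_iff hΛ _).mpr hx₀.2⟩
  · rintro ⟨g, x⟩ ⟨hg, hx⟩ hq
    have hmem : (g, x) ∈ unipotentPoints b V ×ˢ cartanReg b e :=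
      ⟨hg, hx, (functionalProd_ne_zero_iff hΛ _).mp hq⟩
    have hy := hbij.mapsTo hmem
    exact ⟨hy.1, (functionalProd_ne_zero_iff hΛ _).mpr hy.2,
      -- A right inverse of an injective map is also a left inverse.
      hbij.injOn (hψmem _ hy) hmem (hψAd _ hy)⟩
  · intro y hy hs
    have hy' : y ∈ borelReg b e := ⟨hy, (functionalProd_ne_zero_iff hΛ _).mp hs⟩
    have := hψmem y hy'
    exact ⟨⟨this.1, this.2.1⟩, (functionalProd_ne_zero_iff hΛ _).mpr this.2.2, hψAd y hy'⟩
  · intro l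
    obtain ⟨σ, hσ⟩ := exists_leftInverse_rep L V
    obtain ⟨k, hk⟩ := exists_inverse_polynomial b V
    have h1 : IsRegMap (polyFun (Module.End ℂ V × L)) fun p => p.1 :=
      IsRegMap.polyFun (LinearMap.fst ℂ (Module.End ℂ V) L)
    have h2 : IsRegMap (polyFun (Module.End ℂ V × L)) fun p => toEnd ℂ L V p.2 :=
      IsRegMap.polyFun (rep L V ∘ₗ LinearMap.snd ℂ (Module.End ℂ V) L)
    have h3 : IsRegMap (polyFun (Module.End ℂ V × L)) fun p =>
        σ (p.1 * toEnd ℂ L V p.2 * ∑ i ∈ Finset.range k, (1 + -p.1) ^ i) :=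
      ((h1.mul h2).mul (IsRegMap.sum _ fun i _ => ((IsRegMap.const 1).add h1.neg).pow i)).comp σ
    -- The exponent is `0` because the action map is polynomial on all of `N × 𝔥`.
    refine ⟨_, h3 l, 0, ?_⟩
    rintro ⟨_, x⟩ ⟨⟨g, hg, rfl⟩, hx⟩ -
    have h4 := toEnd_Ad hg (cartan_le_borel hx)
    rw [← Units.eq_mul_inv_iff_mul_eq, hk g hg] at h4
    simp only [pow_zero, div_one, ← sub_eq_add_neg]
    rw [← h4, hσ]
  · intro l
    have h1 : IsRegMap (borelFun b e) fun y =>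
        ((G y : Module.End ℂ V), e.cartanProj (y : L)) :=
      hreg.prodMk (IsRegMap.localizedFun e.cartanProj)
    obtain ⟨p, hp, k, hpk⟩ := exists_eq_div_of_mem_localizedFun hΛ (h1 l)
    refine ⟨p, hp, k, fun y hy hs => ?_⟩
    have hy' : y ∈ borelReg b e := ⟨hy, (functionalProd_ne_zero_iff hΛ _).mp hs⟩
    rw [hψ y hy']
    exact hpk ⟨y, hy'⟩

end Elimination

section Series

variable {L : Type*} [LieRing L] [LieAlgebra ℂ L] [FiniteDimensional ℂ L] [IsKilling ℂ L]
  {H : LieSubalgebra ℂ L} [H.IsCartanSubalgebra] {b : (rootSystem H).Base} (e : RootVectors H)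
  {V : Type*} [AddCommGroup V] [Module ℂ V] [LieRingModule L V] [LieModule ℂ L V]
  [FiniteDimensional ℂ V] [LieModule.IsFaithful ℂ L V]

/-! ### The series for the operators `P_α` -/

variable (V) in
theorem lieAct_vec_apply (α : PosRoot b) (f : borelReg b e → ℂ) (y : borelReg b e) :
    lieAct b V e (e.vec α.1) f y = deriv (fun t : ℂ => f (rootFlow e α (-t) y)) 0 := by
  rw [lieAct]
  congr 1
  ext t
  have hz : -t • e.vec α.1 ∈ borelNilradical b := Submodule.smul_mem _ _ (vec_mem_nilradical b e α)
  have hX : toEnd ℂ L V (-t • e.vec α.1) = -t • toEnd ℂ L V (e.vec α.1) := map_smul (rep L V) _ _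
  have hAd : Ad (nilExp (-t • toEnd ℂ L V (e.vec α.1))) (y : L) = rootFlow e α (-t) y := by
    rw [← hX, Ad_nilExp (isNilpotent_toEnd_of_mem_nilradical (V := V) hz)]
    rfl
  rw [hAd, extendZero_apply f (rootFlow e α (-t) y).2]

/-- The flow is polynomial in `t` by nilpotency of `ad e_α`, and the inverted functions do not
change along it. The degree bound is uniform in `y`, so a single truncation works for all points. -/
theorem exists_polynomial_rootFlow (α : PosRoot b) {f : borelReg b e → ℂ} (hf : f ∈ borelFun b e) :
    ∃ M : ℕ, ∀ y, ∃ p : Polynomial ℂ, p.natDegree ≤ M ∧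
      ∀ t, f (rootFlow e α (-t) y) = p.eval t := by
  refine localizedFun_induction (p := fun f => ∃ M : ℕ, ∀ y, ∃ p : Polynomial ℂ,
    p.natDegree ≤ M ∧ ∀ t, f (rootFlow e α (-t) y) = p.eval t) ?_ ?_ ?_ ?_ ?_ hf
  · intro l
    obtain ⟨k, hk⟩ := isNilpotent_ad_vec e α.1
    refine ⟨k, fun y => ⟨∑ i ∈ Finset.range k, Polynomial.C
      ((-1) ^ i * l ((i.factorial : ℂ)⁻¹ • (ad ℂ L (e.vec α.1) ^ i) (y : L))) * Polynomial.X ^ i,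
      ?_, fun t => ?_⟩⟩
    · refine Polynomial.natDegree_sum_le_of_forall_le _ _ fun i hi => ?_
      exact (Polynomial.natDegree_C_mul_X_pow_le _ _).trans (Finset.mem_range.mp hi).le
    · beta_reduce
      rw [coe_rootFlow, nilExp_smul_apply hk, map_sum, Polynomial.eval_finsetSum]
      refine Finset.sum_congr rfl fun i _ => ?_
      rw [map_smul, neg_pow]
      simp
      ring
  · rintro _ ⟨γ, rfl⟩
    refine ⟨0, fun y => ⟨Polynomial.C (e.hHat γ.1 (y : L))⁻¹, by simp, fun t => ?_⟩⟩
    beta_reduce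
    rw [hHat_rootFlow, Polynomial.eval_C]
  · exact fun c => ⟨0, fun y => ⟨Polynomial.C c, by simp, fun t => by simp⟩⟩
  · rintro f - g - ⟨M, hf⟩ ⟨N, hg⟩
    refine ⟨max M N, fun y => ?_⟩
    obtain ⟨p, hp, hfp⟩ := hf y
    obtain ⟨q, hq, hgq⟩ := hg y
    exact ⟨p + q, (Polynomial.natDegree_add_le _ _).trans (max_le_max hp hq), fun t => by
      simp [hfp, hgq]⟩
  · rintro f - g - ⟨M, hf⟩ ⟨N, hg⟩
    refine ⟨M + N, fun y => ?_⟩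
    obtain ⟨p, hp, hfp⟩ := hf y
    obtain ⟨q, hq, hgq⟩ := hg y
    exact ⟨p * q, Polynomial.natDegree_mul_le.trans (add_le_add hp hq), fun t => by
      simp [hfp, hgq]⟩

variable (V) in
-- By the one-parameter group law, acting by `e_α` at a point of the flow line is differentiation in
-- the parameter there. Stating it for all `t` lets the induction differentiate again.
theorem iterate_lieAct_rootFlow (α : PosRoot b) {f : borelReg b e → ℂ}
    {p : Polynomial ℂ} {y : borelReg b e} (hp : ∀ t, f (rootFlow e α (-t) y) = p.eval t) (n : ℕ)
    (t : ℂ) : (lieAct b V e (e.vec α.1))^[n] f (rootFlow e α (-t) y) =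
      (Polynomial.derivative^[n] p).eval t := by
  induction n generalizing t with
  | zero => exact hp t
  | succ n ih =>
    rw [Function.iterate_succ_apply', Function.iterate_succ_apply', lieAct_vec_apply]
    have : (fun s : ℂ => (lieAct b V e (e.vec α.1))^[n] f (rootFlow e α (-s) (rootFlow e α (-t) y)))
        = fun s => (Polynomial.derivative^[n] p).eval (s + t) := by
      ext s
      rw [← ih, neg_add, rootFlow_add]
    rw [this, deriv_comp_add_const (fun s => (Polynomial.derivative^[n] p).eval s), zero_add,
      Polynomial.deriv]

variable (V) in
theorem exists_elimHom_series (α : PosRoot b) (f : borelFun b e) : ∃ M : ℕ,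
    (∀ n ≥ M, (lieAct b V e (e.vec α.1))^[n] f = 0) ∧
    ∀ y : borelReg b e, (elimHom e α f : borelReg b e → ℂ) y =
      ∑ n ∈ Finset.range M, (-1 : ℂ) ^ n / (n.factorial : ℂ) * (e.hHat α.1 y)⁻¹ ^ n *
        e.eHat (negRoot α.1) y ^ n * (lieAct b V e (e.vec α.1))^[n] f y := by
  obtain ⟨M, hM⟩ := exists_polynomial_rootFlow e α f.2
  choose p hdeg hp using hM
  have hD : ∀ n y, (lieAct b V e (e.vec α.1))^[n] f y =
      (Polynomial.derivative^[n] (p y)).eval 0 := by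
    intro n y
    have := iterate_lieAct_rootFlow e V α (hp y) n 0
    rwa [neg_zero, rootFlow_zero] at this
  refine ⟨M + 1, fun n hn => ?_, fun y => ?_⟩
  · ext y
    rw [hD, Polynomial.iterate_derivative_eq_zero ((hdeg y).trans_lt hn)]
    simp
  · have h1 : (elimHom e α f : borelReg b e → ℂ) y =
        (p y).eval (-(e.coeff α.1 (y : L) / e.hHat α.1 (y : L))) := by
      rw [← hp, neg_neg]
      rfl
    -- Elimination runs the flow forward while `p y` uses the parameter `-t`; this is the source of
    -- the sign `(-1)^n`. The coefficients of `p y` are its derivatives at `0` divided by `n!`.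
    rw [h1, Polynomial.eval_eq_sum_range' (Nat.lt_succ_of_le (hdeg y))]
    refine Finset.sum_congr rfl fun n _ => ?_
    have hfac : (n.factorial : ℂ) ≠ 0 := by exact_mod_cast n.factorial_ne_zero
    rw [hD, ← Polynomial.coeff_zero_eq_eval_zero, Polynomial.coeff_iterate_derivative, zero_add,
      Nat.descFactorial_self, nsmul_eq_mul, e.eHat_negRoot, neg_pow, div_pow, div_eq_mul_inv,
      inv_pow]
    field_simp

end Series

section Poisson

variable {E : Type*} [AddCommGroup E] [Module ℂ E] {Λ : Set (Dual ℂ E)}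

/-! ### Derivatives of the elements of the localised function algebras -/

/-- The curve `γ` has derivative `w` at `0`. -/
def IsTangent (γ : ℂ → E) (w : E) : Prop :=
  ∀ l : Dual ℂ E, HasDerivAt (fun t => l (γ t)) (l w) 0

theorem isTangent_line (y w : E) : IsTangent (fun t : ℂ => y + t • w) w := fun l => by
  simpa using ((hasDerivAt_id (0 : ℂ)).mul_const (l w)).const_add (l y)

theorem IsTangent.eventually_mem {γ : ℂ → E} {w : E} (h : IsTangent γ w) (hΛ : Λ.Finite)
    (h0 : γ 0 ∈ nonvanishing Λ Set.univ) :
    ∀ᶠ t in nhds (0 : ℂ), γ t ∈ nonvanishing Λ Set.univ := by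
  have : ∀ᶠ t in nhds (0 : ℂ), ∀ l ∈ Λ, l (γ t) ≠ 0 :=
    (Filter.eventually_all_finite hΛ).mpr fun l hl =>
      (h l).continuousAt.eventually_ne (h0.2 l hl)
  filter_upwards [this] with t ht
  exact ⟨Set.mem_univ _, ht⟩

/-- The derivative is computed along arbitrary curves, so that one differential serves both the
straight lines in the definition of the gradient and the flow of `e_α`. Its values lie in the
algebra, which allows brackets to be iterated. -/
theorem exists_differential (hΛ : Λ.Finite) {ψ : nonvanishing Λ (Set.univ : Set E) → ℂ}
    (hψ : ψ ∈ localizedFun Λ Set.univ) : ∃ G : E →ₗ[ℂ] localizedFun Λ (Set.univ : Set E),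
      ∀ (y : nonvanishing Λ (Set.univ : Set E)) (w : E) (γ : ℂ → E), γ 0 = y → IsTangent γ w →
        HasDerivAt (fun t => extendZero ψ (γ t))
          ((G w : nonvanishing Λ (Set.univ : Set E) → ℂ) y) 0 := by
  refine localizedFun_induction (p := fun ψ => ∃ G : E →ₗ[ℂ] localizedFun Λ (Set.univ : Set E),
      ∀ (y : nonvanishing Λ (Set.univ : Set E)) (w : E) (γ : ℂ → E), γ 0 = y → IsTangent γ w →
        HasDerivAt (fun t => extendZero ψ (γ t))
          ((G w : nonvanishing Λ (Set.univ : Set E) → ℂ) y) 0) ?_ ?_ ?_ ?_ ?_ hψ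
  · intro l
    refine ⟨Algebra.linearMap ℂ _ ∘ₗ l, fun y w γ h0 hγ => ?_⟩
    refine (hγ l).congr_of_eventuallyEq ?_
    filter_upwards [hγ.eventually_mem hΛ (h0 ▸ y.2)] with t ht
    exact extendZero_apply _ ht
  · intro l hl
    refine ⟨LinearMap.smulRight l (-(⟨_, inv_mem_localizedFun hl⟩ ^ 2)), fun y w γ h0 hγ => ?_⟩
    have h1 := (hγ l).inv (by rw [h0]; exact y.2.2 l hl)
    have h2 : -l w / l (γ 0) ^ 2 = ((LinearMap.smulRight l
        (-((⟨_, inv_mem_localizedFun hl⟩ : localizedFun Λ (Set.univ : Set E)) ^ 2)) w :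
          localizedFun Λ (Set.univ : Set E)) : nonvanishing Λ (Set.univ : Set E) → ℂ) y := by
      rw [h0]
      simp [div_eq_mul_inv]
    rw [h2] at h1
    refine h1.congr_of_eventuallyEq ?_
    filter_upwards [hγ.eventually_mem hΛ (h0 ▸ y.2)] with t ht
    exact extendZero_apply _ ht
  · intro c
    refine ⟨0, fun y w γ h0 hγ => ?_⟩
    refine (hasDerivAt_const (0 : ℂ) c).congr_of_eventuallyEq ?_
    filter_upwards [hγ.eventually_mem hΛ (h0 ▸ y.2)] with t ht
    exact extendZero_apply _ ht
  · rintro f - g - ⟨F, hF⟩ ⟨G, hG⟩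
    refine ⟨F + G, fun y w γ h0 hγ => ?_⟩
    refine ((hF y w γ h0 hγ).add (hG y w γ h0 hγ)).congr_of_eventuallyEq ?_
    filter_upwards [hγ.eventually_mem hΛ (h0 ▸ y.2)] with t ht
    simp only [Pi.add_apply, extendZero_apply _ ht]
  · rintro f hf g hg ⟨F, hF⟩ ⟨G, hG⟩
    refine ⟨LinearMap.mulRight ℂ ⟨g, hg⟩ ∘ₗ F + LinearMap.mulLeft ℂ ⟨f, hf⟩ ∘ₗ G,
      fun y w γ h0 hγ => ?_⟩
    have h1 := (hF y w γ h0 hγ).mul (hG y w γ h0 hγ)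
    have hy : γ 0 ∈ nonvanishing Λ Set.univ := h0 ▸ y.2
    have hy' : (⟨γ 0, hy⟩ : nonvanishing Λ (Set.univ : Set E)) = y := Subtype.ext h0
    rw [extendZero_apply _ hy, extendZero_apply _ hy, hy'] at h1
    refine h1.congr_of_eventuallyEq ?_
    filter_upwards [hγ.eventually_mem hΛ hy] with t ht
    simp only [Pi.mul_apply, extendZero_apply _ ht]

end Poisson

section Gradient

variable {L : Type*} [LieRing L] [LieAlgebra ℂ L]

/-! ### Gradients -/

theorem form_formGradient [FiniteDimensional ℂ L] {U : Set L} (κ : LinearMap.BilinForm ℂ L) (hκ : κ.Nondegenerate)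
    {φ : U → ℂ} {y : L} {D : Dual ℂ L} (h : ∀ w, lineDeriv ℂ (extendZero φ) y w = D w) (w : L) :
    κ (formGradient κ hκ φ y) w = D w := by
  have : κ (formGradient κ hκ φ y) = D := by
    refine (finBasis ℂ L).ext fun j => ?_
    simp only [formGradient, h, map_sum, map_smul, LinearMap.sum_apply, LinearMap.smul_apply,
      LinearMap.BilinForm.apply_dualBasis_left, smul_eq_mul]
    simp
  rw [this]

theorem form_left_injective {κ : LinearMap.BilinForm ℂ L} (hκ : κ.Nondegenerate) {u v : L}
    (h : ∀ w, κ u w = κ v w) : u = v := by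
  rw [← sub_eq_zero]
  exact hκ.1 _ fun w => by rw [map_sub, LinearMap.sub_apply, h, sub_self]

theorem lineDeriv_eq_of_differential {U : Set L} {ψ : U → ℂ} {y w : L} {c : ℂ}
    (h : ∀ γ : ℂ → L, γ 0 = y → IsTangent γ w → HasDerivAt (fun t => extendZero ψ (γ t)) c 0) :
    lineDeriv ℂ (extendZero ψ) y w = c :=
  (h (fun t => y + t • w) (by simp) (isTangent_line y w)).deriv

end Gradient

section Poisson

variable {L : Type*} [LieRing L] [LieAlgebra ℂ L] [FiniteDimensional ℂ L] [IsKilling ℂ L]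
  {H : LieSubalgebra ℂ L} [H.IsCartanSubalgebra] {b : (rootSystem H).Base} (e : RootVectors H)

theorem form_formGradient_linear (κ : LinearMap.BilinForm ℂ L) (hκ : κ.Nondegenerate)
    (l : Dual ℂ L) (y : lieReg b e) (w : L) :
    κ (formGradient κ hκ (fun z : lieReg b e => l z) y) w = l w := by
  refine form_formGradient κ hκ (fun w => lineDeriv_eq_of_differential fun γ h0 hγ => ?_) w
  refine (hγ l).congr_of_eventuallyEq ?_
  filter_upwards [hγ.eventually_mem (finite_posFunctionals b e) (h0 ▸ y.2)] with t ht
  exact extendZero_apply _ ht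

/-! ### Invariant forms -/

theorem hHat_negRoot (α : H.root) (y : L) : e.hHat (negRoot α) y = -e.hHat α y := rfl

section Form

variable {κ : LinearMap.BilinForm ℂ L}

theorem form_vec_cartan (hinv : ∀ x y z, κ ⁅x, y⁆ z = κ x ⁅y, z⁆)
    (α : H.root) {h : L} (hh : h ∈ H) : κ (e.vec α) h = 0 := by
  obtain ⟨h', hh'⟩ : ∃ h' : H, (α : Weight ℂ H L) h' ≠ 0 := by
    by_contra! hcon
    exact LieSubalgebra.isNonZero_coe_root α (funext hcon)
  have h1 := hinv (e.vec α) h' h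
  have h2 : ⁅(h' : L), h⁆ = 0 := by
    have : ⁅h', (⟨h, hh⟩ : H)⁆ = 0 := trivial_lie_zero _ _ _ _
    exact congrArg Subtype.val this
  rw [h2, map_zero, ← lie_skew, e.lie_cartan_vec h'.2, map_neg, map_smul, LinearMap.neg_apply,
    LinearMap.smul_apply, neg_eq_zero, smul_eq_mul, e.hHat_of_mem h'.2] at h1
  exact (mul_eq_zero.mp h1).resolve_left hh'

theorem form_vec_vec (hinv : ∀ x y z, κ ⁅x, y⁆ z = κ x ⁅y, z⁆)
    {α γ : H.root} (h : negRoot α ≠ γ) : κ (e.vec α) (e.vec γ) = 0 := by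
  by_contra hne
  refine h (Subtype.ext (DFunLike.coe_injective (funext fun h' => ?_)))
  have h1 := hinv (e.vec α) h' (e.vec γ)
  rw [← lie_skew, e.lie_cartan_vec h'.2, e.lie_cartan_vec h'.2, map_neg, map_smul, map_smul,
    LinearMap.neg_apply, LinearMap.smul_apply, smul_eq_mul, smul_eq_mul, e.hHat_of_mem h'.2,
    e.hHat_of_mem h'.2, ← neg_mul] at h1
  exact mul_right_cancel₀ hne h1

/-- Invariance makes `e_α` orthogonal to `𝔥` and to every root vector except `e_{-α}`, so pairing
with `e_α` reads off a single coordinate. -/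
theorem form_vec (hinv : ∀ x y z, κ ⁅x, y⁆ z = κ x ⁅y, z⁆)
    (α : H.root) (w : L) :
    κ (e.vec α) w = κ (e.vec α) (e.vec (negRoot α)) * e.eHat α w := by
  conv_lhs => rw [e.decomp w]
  rw [map_add, form_vec_cartan e hinv α (e.cartanProj_mem w), zero_add, map_sum,
    Finset.sum_eq_single (negRoot α)]
  · rw [map_smul, smul_eq_mul, mul_comm]; rfl
  · intro γ _ hγ
    rw [map_smul, form_vec_vec e hinv hγ.symm, smul_zero]
  · simp

theorem form_vec_negRoot_ne_zero (hinv : ∀ x y z, κ ⁅x, y⁆ z = κ x ⁅y, z⁆)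
    (hκ : κ.Nondegenerate) (α : H.root) :
    κ (e.vec α) (e.vec (negRoot α)) ≠ 0 := by
  intro h0
  exact e.vec_ne_zero α (hκ.1 _ fun w => by rw [form_vec e hinv, h0, zero_mul])

theorem form_coroot (hinv : ∀ x y z, κ ⁅x, y⁆ z = κ x ⁅y, z⁆)
    (hsymm : ∀ x y, κ x y = κ y x) (α : H.root) (w : L) :
    κ (coroot (α : Weight ℂ H L) : L) w = κ (e.vec α) (e.vec (negRoot α)) * e.hHat α w := by
  have hc : ((coroot (α : Weight ℂ H L) : H) : L) ∈ H := (coroot (α : Weight ℂ H L)).2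
  conv_lhs => rw [e.decomp w]
  rw [map_add, map_sum, Finset.sum_eq_zero, add_zero]
  · rw [← e.lie_vec, hinv, ← lie_skew, e.lie_cartan_vec (e.cartanProj_mem w), hHat_negRoot e,
      e.hHat_cartanProj, neg_smul, neg_neg, map_smul, smul_eq_mul, mul_comm]
  · intro γ _
    rw [map_smul, hsymm, form_vec_cartan e hinv γ hc, smul_zero]

theorem formGradient_eHat (hinv : ∀ x y z, κ ⁅x, y⁆ z = κ x ⁅y, z⁆)
    (hκ : κ.Nondegenerate) (α : H.root) (y : lieReg b e) :
    formGradient κ hκ (fun z : lieReg b e => e.eHat α z) y =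
      (κ (e.vec α) (e.vec (negRoot α)))⁻¹ • e.vec α := by
  refine form_left_injective hκ fun w => ?_
  rw [form_formGradient_linear, map_smul, LinearMap.smul_apply, form_vec e hinv α w, smul_eq_mul,
    inv_mul_cancel_left₀ (form_vec_negRoot_ne_zero e hinv hκ α)]

theorem formGradient_hHat (hinv : ∀ x y z, κ ⁅x, y⁆ z = κ x ⁅y, z⁆)
    (hκ : κ.Nondegenerate) (hsymm : ∀ x y, κ x y = κ y x) (α : H.root)
    (y : lieReg b e) :
    formGradient κ hκ (fun z : lieReg b e => e.hHat α z) y =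
      (κ (e.vec α) (e.vec (negRoot α)))⁻¹ • (coroot (α : Weight ℂ H L) : L) := by
  refine form_left_injective hκ fun w => ?_
  rw [form_formGradient_linear, map_smul, LinearMap.smul_apply, form_coroot e hinv hsymm,
    smul_eq_mul, inv_mul_cancel_left₀ (form_vec_negRoot_ne_zero e hinv hκ α)]

theorem poisson_eHat_eHat (hinv : ∀ x y z, κ ⁅x, y⁆ z = κ x ⁅y, z⁆)
    (hκ : κ.Nondegenerate) (hsymm : ∀ x y, κ x y = κ y x) (α : H.root)
    (y : lieReg b e) :
    poisson κ hκ (fun z : lieReg b e => e.eHat α z) (fun z => e.eHat (negRoot α) z) y =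
      (κ (e.vec α) (e.vec (negRoot α)))⁻¹ * e.hHat α y := by
  have h0 := form_vec_negRoot_ne_zero e hinv hκ α
  rw [poisson, formGradient_eHat e hinv, formGradient_eHat e hinv, smul_lie, lie_smul, e.lie_vec,
    map_smul, map_smul, hsymm (y : L), form_coroot e hinv hsymm, negRoot_negRoot,
    hsymm (e.vec (negRoot α)), smul_eq_mul, smul_eq_mul, inv_mul_cancel_left₀ h0]

/-- In general `{ê_α, ê_{-α}}` is `ĥ_α` divided by this number; comparison at a point where `ĥ_α ≠
0` determines it. -/
theorem form_eq_one_of_isNormalizedForm {κ : LinearMap.BilinForm ℂ L} {hκ : κ.Nondegenerate}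
    {α : PosRoot b} (h : IsNormalizedForm b e α κ hκ) :
    κ (e.vec α.1) (e.vec (negRoot α.1)) = 1 := by
  obtain ⟨x, hx⟩ := exists_mem_cartanReg b e
  have hx' : x ∈ lieReg b e := ⟨Set.mem_univ _, hx.2⟩
  have h1 := h.bracket_e_e ⟨x, hx'⟩
  rw [poisson_eHat_eHat e h.invariant hκ h.symm] at h1
  exact inv_eq_one.mp (mul_eq_right₀ (hx.2 _ ⟨α, rfl⟩) |>.mp h1)

end Form

theorem isNormalizedForm_of_eq_one {κ : LinearMap.BilinForm ℂ L} (hκ : κ.Nondegenerate)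
    (hsymm : ∀ x y, κ x y = κ y x) (hinv : ∀ x y z, κ ⁅x, y⁆ z = κ x ⁅y, z⁆) {α : PosRoot b}
    (h : κ (e.vec α.1) (e.vec (negRoot α.1)) = 1) : IsNormalizedForm b e α κ hκ := by
  have h' : κ (e.vec (negRoot α.1)) (e.vec (negRoot (negRoot α.1))) = 1 := by
    rw [negRoot_negRoot, hsymm, h]
  have hc : ((coroot (α.1 : Weight ℂ H L) : H) : L) ∈ H := (coroot (α.1 : Weight ℂ H L)).2
  have hα : e.hHat α.1 (coroot (α.1 : Weight ℂ H L) : L) = 2 := by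
    rw [e.hHat_of_mem hc]
    exact root_apply_coroot (LieSubalgebra.isNonZero_coe_root α.1)
  refine ⟨hsymm, hinv, fun y => ?_, fun y => ?_, fun y => ?_⟩
  · rw [poisson_eHat_eHat e hinv hκ hsymm, h, inv_one, one_mul]
  · rw [poisson, formGradient_hHat e hinv hκ hsymm, formGradient_eHat e hinv, h, inv_one, one_smul,
      one_smul, e.lie_cartan_vec hc, hα, map_smul, hsymm (y : L), form_vec e hinv, h, one_mul, smul_eq_mul]
  · rw [poisson, formGradient_hHat e hinv hκ hsymm, formGradient_eHat e hinv, h, h', inv_one,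
      one_smul, one_smul, e.lie_cartan_vec hc, hHat_negRoot, hα, map_smul, hsymm (y : L), form_vec e hinv,
      h', one_mul, smul_eq_mul]

theorem exists_isNormalizedForm_smul_killingForm (α : PosRoot b) : ∃ c : ℂ, c ≠ 0 ∧
    ∃ hκ : (c • killingForm ℂ L : LinearMap.BilinForm ℂ L).Nondegenerate,
      IsNormalizedForm b e α (c • killingForm ℂ L) hκ := by
  have hk := e.killing_vec_ne_zero α.1
  have hc := inv_ne_zero hk
  have hnd : (killingForm ℂ L).Nondegenerate := killingForm_nondegenerate ℂ L
  have hκ : ((killingForm ℂ L (e.vec α.1) (e.vec (negRoot α.1)))⁻¹ • killingForm ℂ L :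
      LinearMap.BilinForm ℂ L).Nondegenerate := by
    refine ⟨fun x hx => hnd.1 x fun w => ?_, fun x hx => hnd.2 x fun w => ?_⟩
    · simpa [hk] using hx w
    · simpa [hk] using hx w
  refine ⟨_, hc, hκ, isNormalizedForm_of_eq_one e hκ ?_ ?_ ?_⟩
  · intro x y
    simp [LieModule.traceForm_comm ℂ L L x y]
  · intro x y z
    simp [LieModule.traceForm_apply_lie_apply]
  · simp [hk]

/-! ### Iterated brackets with `ê_α` -/

/-- The gradient of `ê_α` is `e_α`, and invariance turns `κ(y, [e_α, ∇ψ])` into `κ([y, e_α], ∇ψ)`,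
the derivative of `ψ` in direction `[y, e_α]`. -/
theorem poisson_eHat_apply {κ : LinearMap.BilinForm ℂ L} {hκ : κ.Nondegenerate} {α : PosRoot b}
    (h : IsNormalizedForm b e α κ hκ) {ψ : lieReg b e → ℂ} {G : L →ₗ[ℂ] lieFun b e}
    (hG : ∀ (y : lieReg b e) (w : L) (γ : ℂ → L), γ 0 = y → IsTangent γ w →
        HasDerivAt (fun t => extendZero ψ (γ t)) ((G w : lieReg b e → ℂ) y) 0) (y : lieReg b e) :
    poisson κ hκ (fun z : lieReg b e => e.eHat α.1 z) ψ y =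
      (G ⁅(y : L), e.vec α.1⁆ : lieReg b e → ℂ) y := by
  let D : Dual ℂ L := LinearMap.proj y ∘ₗ (lieFun b e).val.toLinearMap ∘ₗ G
  have hD : ∀ w, lineDeriv ℂ (extendZero ψ) (y : L) w = D w := fun w =>
    lineDeriv_eq_of_differential fun γ h0 hγ => hG y w γ h0 hγ
  rw [poisson, formGradient_eHat e h.invariant, form_eq_one_of_isNormalizedForm e h, inv_one,
    one_smul, ← h.invariant, h.symm, form_formGradient κ hκ hD]
  rfl

theorem poisson_eHat_mem {κ : LinearMap.BilinForm ℂ L} {hκ : κ.Nondegenerate} {α : PosRoot b}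
    (h : IsNormalizedForm b e α κ hκ) {ψ : lieReg b e → ℂ} (hψ : ψ ∈ lieFun b e) :
    poisson κ hκ (fun z : lieReg b e => e.eHat α.1 z) ψ ∈ lieFun b e := by
  obtain ⟨G, hG⟩ := exists_differential (finite_posFunctionals b e) hψ
  have : poisson κ hκ (fun z : lieReg b e => e.eHat α.1 z) ψ = ∑ i,
      (fun y : lieReg b e => -((finBasis ℂ L).coord i ∘ₗ ad ℂ L (e.vec α.1)) y) *
        (G (finBasis ℂ L i) : lieReg b e → ℂ) := by
    ext y
    have h1 : G ⁅(y : L), e.vec α.1⁆ =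
        -∑ i, (finBasis ℂ L).repr ⁅e.vec α.1, (y : L)⁆ i • G (finBasis ℂ L i) := by
      conv_lhs => rw [← lie_skew, ← (finBasis ℂ L).sum_repr ⁅e.vec α.1, (y : L)⁆]
      simp only [map_neg, map_sum, map_smul]
    rw [poisson_eHat_apply e h hG, h1]
    simp
  rw [this]
  exact sum_mem fun i _ => mul_mem (neg_mem (linear_mem_localizedFun _)) (G _).2

theorem isTangent_rootFlow (α : PosRoot b) (y : borelReg b e) :
    IsTangent (fun t => (rootFlow e α (-t) y : L)) ⁅(y : L), e.vec α.1⁆ := by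
  intro l
  obtain ⟨k, hk⟩ := isNilpotent_ad_vec e α.1
  have hk2 : ad ℂ L (e.vec α.1) ^ (k + 2) = 0 := pow_eq_zero_of_le (by omega) hk
  let p : Polynomial ℂ := ∑ i ∈ Finset.range (k + 2), Polynomial.C
    ((-1) ^ i * l ((i.factorial : ℂ)⁻¹ • (ad ℂ L (e.vec α.1) ^ i) (y : L))) * Polynomial.X ^ i
  have hp : (fun t => l (rootFlow e α (-t) y : L)) = fun t => p.eval t := by
    ext t
    rw [coe_rootFlow, nilExp_smul_apply hk2, map_sum, Polynomial.eval_finsetSum]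
    refine Finset.sum_congr rfl fun i _ => ?_
    rw [map_smul, neg_pow]
    simp
    ring
  have hd : p.derivative.eval 0 = l ⁅(y : L), e.vec α.1⁆ := by
    have hc : p.coeff 1 = l ⁅(y : L), e.vec α.1⁆ := by
      rw [Polynomial.finsetSum_coeff, Finset.sum_eq_single 1]
      · rw [← lie_skew, map_neg]
        simp [-lie_skew]
      · intro i _ hi
        rw [Polynomial.coeff_C_mul_X_pow, if_neg hi.symm]
      · simp
    rw [← Polynomial.coeff_zero_eq_eval_zero, Polynomial.coeff_derivative, hc]
    simp
  rw [hp, ← hd]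
  exact p.hasDerivAt 0

variable (V : Type*) [AddCommGroup V] [Module ℂ V] [LieRingModule L V] [LieModule ℂ L V]
  [FiniteDimensional ℂ V] [LieModule.IsFaithful ℂ L V]

/-- The vector `[y, e_α]` is the velocity of `exp (-t e_α) y`, a curve inside `𝔟'`. Hence the
bracket on `𝔟'` depends only on the restriction of `ψ`. -/
theorem poisson_eHat_incl {κ : LinearMap.BilinForm ℂ L} {hκ : κ.Nondegenerate} {α : PosRoot b}
    (h : IsNormalizedForm b e α κ hκ) {ψ : lieReg b e → ℂ} (hψ : ψ ∈ lieFun b e)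
    (y : borelReg b e) :
    poisson κ hκ (fun z : lieReg b e => e.eHat α.1 z) ψ (incl _ _ y) =
      lieAct b V e (e.vec α.1) (fun z => ψ (incl _ _ z)) y := by
  obtain ⟨G, hG⟩ := exists_differential (finite_posFunctionals b e) hψ
  rw [poisson_eHat_apply e h hG, lieAct_vec_apply e V]
  have h1 := hG (incl _ _ y) _ _ (by simp [incl]) (isTangent_rootFlow e α y)
  refine h1.deriv.symm.trans ?_
  congr 1
  ext t
  exact extendZero_apply ψ (incl _ _ (rootFlow e α (-t) y)).2

theorem iterate_poisson_eHat_incl {κ : LinearMap.BilinForm ℂ L} {hκ : κ.Nondegenerate}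
    {α : PosRoot b} (h : IsNormalizedForm b e α κ hκ) {ψ : lieReg b e → ℂ} (hψ : ψ ∈ lieFun b e)
    (n : ℕ) :
    (poisson κ hκ (fun z : lieReg b e => e.eHat α.1 z))^[n] ψ ∈ lieFun b e ∧
    (fun y : borelReg b e =>
      (poisson κ hκ (fun z : lieReg b e => e.eHat α.1 z))^[n] ψ (incl _ _ y)) =
      (lieAct b V e (e.vec α.1))^[n] (fun z => ψ (incl _ _ z)) := by
  induction n with
  | zero => exact ⟨hψ, rfl⟩
  | succ n ih =>
    simp only [Function.iterate_succ_apply']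
    refine ⟨poisson_eHat_mem e h ih.1, ?_⟩
    rw [← ih.2]
    ext y
    exact poisson_eHat_incl e V h ih.1 y

/-! ### The kernel of `P` -/

variable (b) in
/-- The ideal generated by the functions `ê_{-α}`, `α ∈ Δ_+`. -/
def nilIdeal : Ideal (borelFun b e) :=
  Ideal.span {u : borelFun b e | ∃ α : PosRoot b, ∀ y : borelReg b e,
    (u : borelReg b e → ℂ) y = e.eHat (negRoot α.1) (y : L)}

/-- For a linear function the difference is a combination of root coordinates; inverted functions
and constants are fixed by `P`. Products follow from multiplicativity of `P` and `xy - x'y' = y(x -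
x') + x'(y - y')`. -/
theorem sub_projHom_mem (f : borelFun b e) : f - projHom b e f ∈ nilIdeal b e := by
  obtain ⟨f, hf⟩ := f
  refine localizedFun_induction (p := fun f => ∀ hf : f ∈ borelFun b e,
    (⟨f, hf⟩ : borelFun b e) - projHom b e ⟨f, hf⟩ ∈ nilIdeal b e) ?_ ?_ ?_ ?_ ?_ hf hf
  · intro l hl
    have key : (⟨fun y => l (y : L), hl⟩ : borelFun b e) - projHom b e ⟨fun y => l (y : L), hl⟩ =
        ∑ α : H.root, algebraMap ℂ (borelFun b e) (l (e.vec α)) *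
          ⟨fun y => e.coeff α (y : L), linear_mem_localizedFun _⟩ := by
      ext y
      have h1 : l (y : L) - l (e.cartanProj (y : L)) = ∑ α, l (e.vec α) * e.coeff α (y : L) := by
        conv_lhs => enter [1]; rw [e.decomp (y : L)]
        simp [mul_comm]
      rw [AddSubmonoidClass.coe_finsetSum, Finset.sum_apply]
      exact h1
    rw [key]
    refine Ideal.sum_mem _ fun α _ => Ideal.mul_mem_left _ _ ?_
    by_cases hα : b.IsPos α
    · exact Ideal.subset_span ⟨⟨α, hα⟩, fun y => by rw [e.eHat_negRoot]⟩
    -- Coordinates at roots that are not positive vanish on `𝔟`.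
    · convert Ideal.zero_mem _ using 1
      ext y
      exact coeff_of_mem_borel e y.2.1 hα
  · rintro _ ⟨γ, rfl⟩ hl
    convert Ideal.zero_mem _
    rw [sub_eq_zero]
    ext y
    change _ = (e.hHat γ.1 (e.cartanProj (y : L)))⁻¹
    rw [e.hHat_cartanProj]
  · intro c hc
    convert Ideal.zero_mem _
    rw [sub_eq_zero]
    rfl
  · intro f hf g hg ihf ihg hfg
    have : (⟨f + g, hfg⟩ : borelFun b e) = ⟨f, hf⟩ + ⟨g, hg⟩ := rfl
    rw [this, map_add, add_sub_add_comm]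
    exact add_mem (ihf hf) (ihg hg)
  · intro f hf g hg ihf ihg hfg
    have : (⟨f * g, hfg⟩ : borelFun b e) = ⟨f, hf⟩ * ⟨g, hg⟩ := rfl
    have h2 : ∀ x y x' y' : borelFun b e, x * y - x' * y' = y * (x - x') + x' * (y - y') := by
      intros; ring
    rw [this, map_mul, h2]
    exact add_mem (Ideal.mul_mem_left _ _ (ihf hf)) (Ideal.mul_mem_left _ _ (ihg hg))

theorem projHom_eq_zero_iff (f : borelFun b e) : projHom b e f = 0 ↔ f ∈ nilIdeal b e := by
  refine ⟨fun h => by simpa [h] using sub_projHom_mem e f, fun h => ?_⟩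
  suffices nilIdeal b e ≤ RingHom.ker (projHom b e) from this h
  refine Ideal.span_le.mpr ?_
  rintro u ⟨α, hu⟩
  rw [SetLike.mem_coe, RingHom.mem_ker]
  ext y
  have := hu (regProj e y)
  rw [e.eHat_negRoot] at this
  change (u : borelReg b e → ℂ) (regProj e y) = 0
  rw [this]
  exact e.coeff_of_mem (e.cartanProj_mem y) _

end Poisson

section Projection

variable {L : Type*} [LieRing L] [LieAlgebra ℂ L] [FiniteDimensional ℂ L] [IsKilling ℂ L]
  {H : LieSubalgebra ℂ L} [H.IsCartanSubalgebra] (b : (rootSystem H).Base) (e : RootVectors H)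
  (V : Type*) [AddCommGroup V] [Module ℂ V] [LieRingModule L V] [LieModule ℂ L V]
  [FiniteDimensional ℂ V] [LieModule.IsFaithful ℂ L V]

/-! ### The operator `P` as a projection onto the invariants -/

theorem isProjectionOperator_projHom :
    IsProjectionOperator b V e (projHom b e).toLinearMap := by
  intro f g hg x hx
  have hx' := cartanReg_subset_borelReg e hx
  have hy := mem_borelReg_of_sub_mem e hx' (Ad_sub_mem hg hx'.1)
  refine ⟨hx', hy, congrArg (f : borelReg b e → ℂ) (Subtype.ext ?_)⟩
  change e.cartanProj (Ad g x) = x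
  rw [cartanProj_Ad e hg hx'.1, e.cartanProj_of_mem hx.1]

theorem isInvariant_projHom (f : borelFun b e) :
    IsInvariant b V e (projHom b e f : borelReg b e → ℂ) := fun _ hg y =>
  ⟨mem_borelReg_of_sub_mem e y.2 (Ad_sub_mem hg y.2.1),
    congrArg (f : borelReg b e → ℂ) (Subtype.ext (cartanProj_Ad e hg y.2.1))⟩

/-- Each `y ∈ 𝔟'` is in the `N`-orbit of its Cartan part, so an invariant function takes the same
value at both. -/
theorem projHom_eq_self_of_isInvariant {f : borelFun b e}
    (hf : IsInvariant b V e (f : borelReg b e → ℂ)) : projHom b e f = f := by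
  obtain ⟨G, hG, -, hAd⟩ := exists_unipotent_section b e V
  ext y
  obtain ⟨hy, h⟩ := hf _ ⟨G y, hG y, rfl⟩ (regProj e y)
  exact h.symm.trans (congrArg (f : borelReg b e → ℂ) (Subtype.ext (hAd y)))

end Projection

end QuasiClassical

end

/-! ### Assembly of the theorem -/

theorem proposition2 {L : Type*} [LieRing L] [LieAlgebra ℂ L] [FiniteDimensional ℂ L]
    [LieAlgebra.IsSemisimple ℂ L]
    (V : Type*) [AddCommGroup V] [Module ℂ V] [FiniteDimensional ℂ V] [LieRingModule L V]
    [LieModule ℂ L V] [LieModule.IsFaithful ℂ L V]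
    (H : LieSubalgebra ℂ L) [H.IsCartanSubalgebra]
    (b : (LieAlgebra.IsKilling.rootSystem H).Base) (e : QuasiClassical.RootVectors H) :
    -- the action map `N × 𝔥 → 𝔟` is a birational equivalence
    QuasiClassical.IsBirational
      (QuasiClassical.unipotentPoints b V ×ˢ (H : Set L)) (QuasiClassical.borel b : Set L)
      (fun p : Module.End ℂ V × L => QuasiClassical.Ad p.1 p.2) ∧
    -- it restricts to a bijection `N × 𝔥' → 𝔟'`
    Set.BijOn (fun p : Module.End ℂ V × L => QuasiClassical.Ad p.1 p.2)
      (QuasiClassical.unipotentPoints b V ×ˢ QuasiClassical.cartanReg b e)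
      (QuasiClassical.borelReg b e) ∧
    -- for each positive root, a multiple of the Killing form is normalised as required
    (∀ α : QuasiClassical.PosRoot b, ∃ c : ℂ, c ≠ 0 ∧
      ∃ hκ : (c • killingForm ℂ L : LinearMap.BilinForm ℂ L).Nondegenerate,
        QuasiClassical.IsNormalizedForm b e α (c • killingForm ℂ L) hκ) ∧
    ∃ (P : Module.End ℂ (QuasiClassical.borelFun b e))
      (Pα : QuasiClassical.PosRoot b → Module.End ℂ (QuasiClassical.borelFun b e)),
      -- `P` is the operator corresponding to the action map, a projection onto the invariants
      QuasiClassical.IsProjectionOperator b V e P ∧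
      (∀ f, QuasiClassical.IsInvariant b V e (P f)) ∧
      (∀ f : QuasiClassical.borelFun b e, QuasiClassical.IsInvariant b V e f → P f = f) ∧
      -- definition of the operators `P_α`
      (∀ α f, ∀ y : QuasiClassical.borelReg b e,
        ∃ hy : QuasiClassical.Ad (QuasiClassical.rootElement b V e α y) (y : L) ∈
            QuasiClassical.borelReg b e,
          (Pα α f : QuasiClassical.borelReg b e → ℂ) y =
            (f : QuasiClassical.borelReg b e → ℂ) ⟨_, hy⟩) ∧
      -- the factorisation of `P` along normal orderings: `P = P_{β_m} ⋯ P_{β_1}`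
      (∀ (m : ℕ) (β : Fin m ≃ QuasiClassical.PosRoot b), QuasiClassical.IsNormalOrdering b β →
        P = ((List.ofFn fun i => Pα (β i)).reverse).prod) ∧
      -- the series for `P_α` in terms of the action of `e_α`, with finitely many nonzero terms
      (∀ (α : QuasiClassical.PosRoot b) (f : QuasiClassical.borelFun b e), ∃ M : ℕ,
        (∀ n ≥ M, (QuasiClassical.lieAct b V e (e.vec α.1))^[n] f = 0) ∧
        ∀ y : QuasiClassical.borelReg b e, (Pα α f : QuasiClassical.borelReg b e → ℂ) y =
          ∑ n ∈ Finset.range M, (-1 : ℂ) ^ n / (n.factorial : ℂ) * (e.hHat α.1 y)⁻¹ ^ n *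
            e.eHat (QuasiClassical.negRoot α.1) y ^ n *
            (QuasiClassical.lieAct b V e (e.vec α.1))^[n] f y) ∧
      -- the series for `P_α` in terms of Poisson brackets, for any representative `F` of `f`
      (∀ (α : QuasiClassical.PosRoot b) (κ : LinearMap.BilinForm ℂ L) (hκ : κ.Nondegenerate),
        QuasiClassical.IsNormalizedForm b e α κ hκ →
        ∀ (f : QuasiClassical.borelFun b e) (F : QuasiClassical.lieFun b e),
        (∀ y, (F : QuasiClassical.lieReg b e → ℂ) (QuasiClassical.incl _ _ y) =
          (f : QuasiClassical.borelReg b e → ℂ) y) →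
        ∃ M : ℕ,
          (∀ n ≥ M, ∀ y : QuasiClassical.borelReg b e,
            (QuasiClassical.poisson κ hκ (fun z : QuasiClassical.lieReg b e => e.eHat α.1 z))^[n]
              F (QuasiClassical.incl _ _ y) = 0) ∧
          ∀ y : QuasiClassical.borelReg b e, (Pα α f : QuasiClassical.borelReg b e → ℂ) y =
            ∑ n ∈ Finset.range M, (-1 : ℂ) ^ n / (n.factorial : ℂ) * (e.hHat α.1 y)⁻¹ ^ n *
              e.eHat (QuasiClassical.negRoot α.1) y ^ n *
              (QuasiClassical.poisson κ hκ
                (fun z : QuasiClassical.lieReg b e => e.eHat α.1 z))^[n]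
                F (QuasiClassical.incl _ _ y)) ∧
      -- the kernel of `P` is the ideal generated by the functions `ê_{-α}`, `α ∈ Δ_+`
      (∀ f, P f = 0 ↔ f ∈ Ideal.span {u : QuasiClassical.borelFun b e |
        ∃ α : QuasiClassical.PosRoot b, ∀ y : QuasiClassical.borelReg b e,
          (u : QuasiClassical.borelReg b e → ℂ) y =
            e.eHat (QuasiClassical.negRoot α.1) (y : L)}) := by
  open QuasiClassical in
  refine ⟨isBirational_Ad b V e, bijOn_Ad b e V, exists_isNormalizedForm_smul_killingForm e,
    (projHom b e).toLinearMap, fun α => (elimHom e α).toLinearMap,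
    isProjectionOperator_projHom b e V, isInvariant_projHom b e V,
    fun f hf => projHom_eq_self_of_isInvariant b e V hf, fun α f y => ?_, fun m β hβ => ?_,
    exists_elimHom_series e V, fun α κ hκ h f F hF => ?_, projHom_eq_zero_iff e⟩
  · have h := Ad_rootElement e V α y
    exact ⟨h ▸ (elim e α y).2,
      congrArg (f : borelReg b e → ℂ) (Subtype.ext h.symm)⟩
  · have hls : ∀ γ, γ ∈ (List.ofFn β).reverse := fun γ => by
      rw [List.mem_reverse, List.mem_ofFn]
      exact β.surjective γ
    rw [← prod_elimHom_eq_projHom e hβ.isEliminationOrder hls, List.map_reverse, List.map_ofFn]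
    rfl
  · obtain ⟨M, hM, hsum⟩ := exists_elimHom_series e V α f
    have hf : (fun z => (F : lieReg b e → ℂ) (incl _ _ z)) = (f : borelReg b e → ℂ) := funext hF
    have hn : ∀ n (y : borelReg b e), (poisson κ hκ fun z : lieReg b e => e.eHat α.1 z)^[n] F
        (incl _ _ y) = (lieAct b V e (e.vec α.1))^[n] f y := fun n y => by
      rw [← hf]
      exact congrFun (iterate_poisson_eHat_incl e V h F.2 n).2 y
    refine ⟨M, fun n hnM y => ?_, fun y => ?_⟩
    · rw [hn, hM n hnM]
      rfl
    · simp only [hn]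
      exact hsum y
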